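/- All graphs are finite, simple and connected. For a graph $G$ write $$AZI(G)=\sum_{uv\in E(G)}\left(\frac{d(u)d(v)}{d(u)+d(v)-2}\right)^3 .$$ For $k\ge 1$, a $k$-apex tree is a connected graph $G$ such that $G-X$ is a tree for some $X\subset V(G)$ with $|X|=k$, while $G-X$ is not a tree for any $X\subset V(G)$ with $|X|<k$. Let $\mathcal U_n^k$ be the class of unicyclic graphs (connected, with as many edges as vertices) on $n$ vertices that are $k$-apex trees. For $q\ge 5$ let $Z_q$ be the unique tree on $q$ vertices with $q-2$ pendant vertices, one vertex of degree $2$ and one vertex of degree $q-2$; its special pendant vertex is the pendant vertex adjacent to the vertex of degree $2$. Let $Z_4=P_4$, both of whose end vertices are called special. Consider unicyclic graphs whose cycle is a triangle $u_1u_2u_3$, with a tree $T_{u_i}$ hanging at each $u_i$ (so that $u_i\in V(T_{u_i})$). - $A_{s_1,s_2,s_3}$ ($s_i\ge 4$): each $T_{u_i}$ is $Z_{s_i}$ with $u_i$ a special pendant vertex. - $B_{s_1,s_2,s_3}$ ($s_1\ge 2$, $s_2,s_3\ge 4$): $T_{u_1}=K_{1,s_1-1}$ with center $u_1$, and for $i=2,3$,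 $T_{u_i}=Z_{s_i}$ with $u_i$ a special pendant vertex. - $C_{s_1,s_2,s_3}$ ($s_1\ge 2$, $s_2\ge 3$, $s_3\ge 4$): $T_{u_1}=K_{1,s_1-1}$ with center $u_1$; $T_{u_2}=K_{1,s_2-1}$ with $u_2$ a pendant vertex of it; $T_{u_3}=Z_{s_3}$ with $u_3$ a special pendant vertex. **Proposition 3.1.** Let $k\ge 4$ and $n\ge 3k+3$. Then, up to isomorphism, the unique graph with minimum $AZI$ in $\mathcal U_n^k$ is $$\begin{cases} A_{k,\lfloor (n-k)/2\rfloor,\lceil (n-k)/2\rceil} & \text{if } k\ge 7,\\ B_{6,\lfloor n/2\rfloor-3,\lceil n/2\rceil-3} & \text{if } k=6,\\ C_{k,k,n-2k} & \text{if } 4\le k\le 5.\end{cases}$$ That is, a graph has minimum $AZI$ in $\mathcal U_n^k$ if and only if it is isomorphic to the graph displayed. -/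

import Mathlib

open Classical in
/-- The augmented Zagreb index
`AZI(G) = ∑_{uv ∈ E(G)} (d(u) d(v) / (d(u) + d(v) - 2))³`, as a real number. -/
noncomputable def augmentedZagrebIndex {V : Type*} [Fintype V] (G : SimpleGraph V) : ℝ :=
  ∑ e ∈ G.edgeFinset,
    Sym2.lift ⟨fun u v =>
      (((G.degree u : ℝ) * (G.degree v : ℝ)) / ((G.degree u : ℝ) + (G.degree v : ℝ) - 2)) ^ 3,
      fun u v => by
        dsimp only
        rw [mul_comm (G.degree u : ℝ), add_comm (G.degree u : ℝ)]⟩ e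

/-- `G` is a `k`-apex tree: `G` is connected, some `k`-subset `X` of the vertices has `G - X` a
tree, and `G - X` is not a tree for any set `X` of fewer than `k` vertices. -/
def IsApexTree {V : Type*} (k : ℕ) (G : SimpleGraph V) : Prop :=
  G.Connected ∧
  (∃ X : Finset V, X.card = k ∧ (G.induce {v | v ∉ X}).IsTree) ∧
  ∀ X : Finset V, X.card < k → ¬ (G.induce {v | v ∉ X}).IsTree

/-- A unicyclic graph: a connected graph with as many edges as vertices. -/
def IsUnicyclic {V : Type*} (G : SimpleGraph V) : Prop :=
  G.Connected ∧ G.edgeSet.ncard = Nat.card V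

/-- The class of unicyclic `k`-apex trees on the vertex set `V`. -/
def unicyclicApexTrees (V : Type*) (k : ℕ) : Set (SimpleGraph V) :=
  {G | IsUnicyclic G ∧ IsApexTree k G}

/-- `G` has minimum augmented Zagreb index in the class of graphs `S`. -/
def HasMinAZI {V : Type*} [Fintype V] (S : Set (SimpleGraph V)) (G : SimpleGraph V) : Prop :=
  G ∈ S ∧ ∀ H ∈ S, augmentedZagrebIndex G ≤ augmentedZagrebIndex H

/-! Rooted trees: the vertices are `0, …, q - 1`, and the root is always the vertex `0`. -/

/-- The star `K_{1,q-1}`, rooted at its center (`q ≥ 1`): the vertex `0` is joined to all others. -/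
def centerStar (q : ℕ) : SimpleGraph (Fin q) :=
  SimpleGraph.fromRel fun i _ => i.val = 0

/-- The star `K_{1,q-1}`, rooted at a pendant vertex (`q ≥ 3`): the vertex `1` is joined to all
others, and the root is the pendant vertex `0`. -/
def leafStar (q : ℕ) : SimpleGraph (Fin q) :=
  SimpleGraph.fromRel fun i _ => i.val = 1

/-- The tree `Z_q` (`q ≥ 4`), rooted at its special pendant vertex. It is the path `0 - 1 - 2`
with the `q - 3` further vertices `3, …, q - 1` all joined to `2`: for `q ≥ 5` it has `q - 2`
pendant vertices, one `2`-vertex (namely `1`) and one `(q - 2)`-vertex (namely `2`), and `0` is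
the pendant vertex adjacent to the `2`-vertex; for `q = 4` it is the path `P_4` rooted at an
end vertex. -/
def zTree (q : ℕ) : SimpleGraph (Fin q) :=
  SimpleGraph.fromRel fun i j =>
    (i.val = 0 ∧ j.val = 1) ∨ (i.val = 1 ∧ j.val = 2) ∨ (i.val = 2 ∧ 3 ≤ j.val)

/-- The graph with a triangle `u₁u₂u₃` such that the rooted tree `T i (s i)` hangs at `u_i`;
here `u_i` is the root `0` of the `i`-th tree. -/
def triangleWithTrees (T : Fin 3 → (q : ℕ) → SimpleGraph (Fin q)) (s : Fin 3 → ℕ) :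
    SimpleGraph (Σ i : Fin 3, Fin (s i)) where
  Adj x y :=
    (∃ (i : Fin 3) (a b : Fin (s i)), x = ⟨i, a⟩ ∧ y = ⟨i, b⟩ ∧ (T i (s i)).Adj a b) ∨
    (x.1 ≠ y.1 ∧ x.2.val = 0 ∧ y.2.val = 0)
  symm := by
    constructor
    rintro x y (⟨i, a, b, hx, hy, h⟩ | ⟨h, hx, hy⟩)
    · exact Or.inl ⟨i, b, a, hy, hx, h.symm⟩
    · exact Or.inr ⟨h.symm, hy, hx⟩
  loopless := by
    constructor
    rintro x (⟨i, a, b, hx, hy, h⟩ | ⟨h, -, -⟩)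
    · rw [hx] at hy
      obtain rfl : a = b := by simpa using hy
      exact h.ne rfl
    · exact h rfl

/-- `A_{s₁,s₂,s₃}`: `T_{u_i} = Z_{s_i}` rooted at its special pendant vertex (`s_i ≥ 4`). -/
def graphA (s₁ s₂ s₃ : ℕ) : SimpleGraph (Σ i : Fin 3, Fin (![s₁, s₂, s₃] i)) :=
  triangleWithTrees ![zTree, zTree, zTree] ![s₁, s₂, s₃]

/-- `B_{s₁,s₂,s₃}`: `T_{u₁} = K_{1,s₁-1}` rooted at its center, `T_{u₂} = Z_{s₂}` and
`T_{u₃} = Z_{s₃}` rooted at their special pendant vertices (`s₁ ≥ 2`, `s₂, s₃ ≥ 4`). -/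
def graphB (s₁ s₂ s₃ : ℕ) : SimpleGraph (Σ i : Fin 3, Fin (![s₁, s₂, s₃] i)) :=
  triangleWithTrees ![centerStar, zTree, zTree] ![s₁, s₂, s₃]

/-- `C_{s₁,s₂,s₃}`: `T_{u₁} = K_{1,s₁-1}` rooted at its center, `T_{u₂} = K_{1,s₂-1}` rooted at
a pendant vertex, `T_{u₃} = Z_{s₃}` rooted at its special pendant vertex
(`s₁ ≥ 2`, `s₂ ≥ 3`, `s₃ ≥ 4`). -/
def graphC (s₁ s₂ s₃ : ℕ) : SimpleGraph (Σ i : Fin 3, Fin (![s₁, s₂, s₃] i)) :=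
  triangleWithTrees ![centerStar, leafStar, zTree] ![s₁, s₂, s₃]

/-!
Orient the edges of a unicyclic graph towards its cycle, and the cycle cyclically; the graph is then
the functional graph of a self-map `φ`, with a tree hanging at each periodic point. Deleting a set
of vertices leaves a tree precisely when what is left is connected and misses a cycle vertex, hence
the whole tree hanging there or else everything outside it: the graph is a `k`-apex tree exactly
when the smallest hanging tree has `k` vertices.

The weight `w a b` of an edge with end degrees `a` and `b` is supermodular on `[2, ∞)²`, so that
`w a b ≥ w 3 a + w 3 b - w 3 3` for `a, b ≥ 3`, with equality if one of the degrees is `3`. Hence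
`AZI - n` is at least the sum over the cycle vertices of charges that depend only on the hanging
trees. Trees with at least four vertices have charges exceeding `21`, so an optimal cycle is a
triangle. Among the trees of a given size, the charge is least for a star with its center on the
cycle, for a star with a leaf on the cycle or for `Z`. Two stars with their centers on the cycle
interact too much to be optimal, and a single one has as few vertices as possible because its charge
increases with the size. The charge of `Z` decreases and is strictly convex in the size, which
balances the sizes of two trees of this kind.
-/

open Function Finset

namespace FunctionalGraph

variable {V : Type*} [Fintype V]

open Classical in
/-- The periodic points of a self-map `φ`, that is, the vertices on the cycles of the functional
graph with the arcs `v → φ v`. -/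
noncomputable def core (φ : V → V) : Finset V := univ.filter (· ∈ periodicPts φ)

open Classical in
/-- The non-periodic preimages of `v`: its children in the rooted forest that remains when the
arcs between periodic points are removed. -/
noncomputable def children (φ : V → V) (v : V) : Finset V :=
  univ.filter fun w => w ∉ core φ ∧ φ w = v

open Classical in
/-- The vertex set of the tree hanging at `v`: the points whose orbit reaches `v` through
non-periodic points. -/
noncomputable def branch (φ : V → V) (v : V) : Finset V :=
  univ.filter fun u => ∃ i, φ^[i] u = v ∧ ∀ j < i, φ^[j] u ∉ core φ

open Classical in
/-- The degree of `v` in the undirected functional graph when there are no cycles of length at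
most two: the arc leaving `v` is counted besides the arcs entering it. -/
noncomputable def deg (φ : V → V) (v : V) : ℕ := 1 + (univ.filter fun w => φ w = v).card

variable {φ : V → V} {u v w : V}

lemma mem_core : v ∈ core φ ↔ v ∈ periodicPts φ := by simp [core]

lemma mem_children : w ∈ children φ v ↔ w ∉ core φ ∧ φ w = v := by simp [children]

lemma mem_branch : u ∈ branch φ v ↔ ∃ i, φ^[i] u = v ∧ ∀ j < i, φ^[j] u ∉ core φ := by simp [branch]

lemma map_mem_core (hv : v ∈ core φ) : φ v ∈ core φ := by
  rw [mem_core] at *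
  exact (bijOn_periodicPts φ).mapsTo hv

lemma mapsTo_core (φ : V → V) : Set.MapsTo φ (core φ) (core φ) := fun _ => map_mem_core

lemma iterate_mem_core (hv : v ∈ core φ) (i : ℕ) : φ^[i] v ∈ core φ := by
  induction i with
  | zero => exact hv
  | succ i ih => rw [iterate_succ_apply']; exact map_mem_core ih

lemma mem_core_of_iterate_eq {i : ℕ} (hi : 0 < i) (h : φ^[i] v = v) : v ∈ core φ :=
  mem_core.2 ⟨i, hi, h⟩

lemma injOn_core : Set.InjOn φ (core φ) := by
  have : ((core φ : Finset V) : Set V) = periodicPts φ := by ext; simp [mem_core]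
  rw [this]
  exact (bijOn_periodicPts φ).injOn

lemma exists_pred_of_mem_core (hv : v ∈ core φ) : ∃ w ∈ core φ, φ w = v := by
  rw [mem_core] at hv
  obtain ⟨w, hw, rfl⟩ := (bijOn_periodicPts φ).surjOn hv
  exact ⟨w, mem_core.2 hw, rfl⟩

lemma exists_iterate_mem_core (φ : V → V) (v : V) : ∃ i, φ^[i] v ∈ core φ := by
  obtain ⟨i, j, hij, h⟩ := Finite.exists_ne_map_eq_of_infinite (fun i : ℕ => φ^[i] v)
  wlog hlt : i < j generalizing i j
  · exact this j i hij.symm h.symm (by omega)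
  refine ⟨i, mem_core_of_iterate_eq (i := j - i) (by omega) ?_⟩
  rw [← iterate_add_apply, Nat.sub_add_cancel hlt.le]
  exact h.symm

lemma self_mem_branch (v : V) : v ∈ branch φ v := mem_branch.2 ⟨0, rfl, by simp⟩

lemma mem_branch_iff_of_mem_core (hv : v ∈ core φ) (hu : u ∈ core φ) :
    u ∈ branch φ v ↔ u = v := by
  refine ⟨fun h => ?_, fun h => by subst h; exact self_mem_branch _⟩
  obtain ⟨i, hi, h⟩ := mem_branch.1 h
  rcases Nat.eq_zero_or_pos i with rfl | hpos
  · exact hi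
  · exact absurd hu (h 0 hpos)

lemma mem_branch_iff : u ∈ branch φ v ↔ u = v ∨ ∃ w ∈ children φ v, u ∈ branch φ w := by
  constructor
  · rintro h
    obtain ⟨i, hi, h⟩ := mem_branch.1 h
    cases i with
    | zero => exact Or.inl hi
    | succ i =>
      rw [iterate_succ_apply'] at hi
      exact Or.inr ⟨φ^[i] u, mem_children.2 ⟨h i (by omega), hi⟩,
        mem_branch.2 ⟨i, rfl, fun j hj => h j (by omega)⟩⟩
  · rintro (rfl | ⟨w, hw, h⟩)
    · exact self_mem_branch u
    · obtain ⟨i, rfl, h'⟩ := mem_branch.1 h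
      obtain ⟨hw', rfl⟩ := mem_children.1 hw
      refine mem_branch.2 ⟨i + 1, iterate_succ_apply' _ _ _, fun j hj => ?_⟩
      rcases Nat.lt_succ_iff_lt_or_eq.1 hj with hj | rfl
      · exact h' j hj
      · exact hw'

lemma notMem_branch_of_mem_children (hw : w ∈ children φ v) : v ∉ branch φ w := by
  intro h
  obtain ⟨i, hi, -⟩ := mem_branch.1 h
  obtain ⟨hw', rfl⟩ := mem_children.1 hw
  exact hw' (mem_core_of_iterate_eq (i := i + 1) (by omega) (by rw [iterate_succ_apply]; exact hi))

lemma disjoint_branch_of_mem_children {w' : V} (hw : w ∈ children φ v) (hw' : w' ∈ children φ v)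
    (hne : w ≠ w') : Disjoint (branch φ w) (branch φ w') := by
  rw [Finset.disjoint_left]
  intro u hu hu'
  obtain ⟨i, hi, -⟩ := mem_branch.1 hu
  obtain ⟨j, hj, -⟩ := mem_branch.1 hu'
  wlog hlt : i ≤ j generalizing i j w w'
  · exact this hw' hw hne.symm hu' hu j hj i hi (by omega)
  obtain ⟨m, rfl⟩ := Nat.exists_eq_add_of_le hlt
  cases m with
  | zero => exact hne (hi ▸ hj)
  | succ m =>
    rw [mem_children] at hw hw'
    have h1 : φ^[m] v = w' := by
      rw [← hw.2, ← hi, ← hj, ← iterate_succ_apply, ← iterate_add_apply]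
      congr 1; omega
    have hv : v ∈ core φ := mem_core_of_iterate_eq (i := m + 1) (by omega)
      (by rw [iterate_succ_apply', h1, hw'.2])
    exact hw'.1 (h1 ▸ iterate_mem_core hv m)

lemma map_mem_branch (hu : u ∈ branch φ v) (hne : u ≠ v) : φ u ∈ branch φ v := by
  obtain ⟨i, hi, h⟩ := mem_branch.1 hu
  cases i with
  | zero => exact absurd hi hne
  | succ i =>
    refine mem_branch.2 ⟨i, by rwa [iterate_succ_apply] at hi, fun j hj => ?_⟩
    rw [← iterate_succ_apply]
    exact h (j + 1) (by omega)

lemma mem_branch_of_map_mem_branch (hu : φ u ∈ branch φ v) (huc : u ∉ core φ) :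
    u ∈ branch φ v := by
  obtain ⟨i, hi, h⟩ := mem_branch.1 hu
  refine mem_branch.2 ⟨i + 1, by rwa [iterate_succ_apply], fun j hj => ?_⟩
  cases j with
  | zero => exact huc
  | succ j => rw [iterate_succ_apply]; exact h j (by omega)

open Classical in
lemma branch_eq (φ : V → V) (v : V) :
    branch φ v = insert v ((children φ v).biUnion (branch φ)) := by
  ext u; simp [mem_branch_iff (v := v)]

variable {M : Type*} [AddCommMonoid M]

lemma sum_branch (F : V → M) (v : V) :
    ∑ u ∈ branch φ v, F u = F v + ∑ w ∈ children φ v, ∑ u ∈ branch φ w, F u := by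
  classical
  rw [branch_eq, Finset.sum_insert, Finset.sum_biUnion]
  · exact fun w hw w' hw' hne => disjoint_branch_of_mem_children hw hw' hne
  · simp only [Finset.mem_biUnion, not_exists, not_and]
    exact fun w hw => notMem_branch_of_mem_children hw

lemma card_branch (v : V) : (branch φ v).card = 1 + ∑ w ∈ children φ v, (branch φ w).card := by
  simpa only [Finset.card_eq_sum_ones] using sum_branch (φ := φ) (fun _ => 1) v

lemma card_branch_lt_of_mem_children (hw : w ∈ children φ v) :
    (branch φ w).card < (branch φ v).card := by
  have := Finset.single_le_sum (f := fun w => (branch φ w).card) (fun _ _ => Nat.zero_le _) hw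
  have := card_branch (φ := φ) v
  omega

lemma children_induction {P : V → Prop} (h : ∀ v, (∀ w ∈ children φ v, P w) → P v) (v : V) :
    P v :=
  (measure fun v => (branch φ v).card).wf.induction v fun v ih =>
    h v fun w hw => ih w (card_branch_lt_of_mem_children hw)

lemma card_branch_pos (v : V) : 0 < (branch φ v).card := Finset.card_pos.2 ⟨v, self_mem_branch v⟩

lemma disjoint_branch_of_mem_core (hv : v ∈ core φ) (hw : w ∈ core φ) (hne : v ≠ w) :
    Disjoint (branch φ v) (branch φ w) := by
  rw [Finset.disjoint_left]
  intro u hu hu'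
  obtain ⟨i, hi, h⟩ := mem_branch.1 hu
  obtain ⟨j, hj, h'⟩ := mem_branch.1 hu'
  rcases lt_trichotomy i j with hij | rfl | hij
  · exact h' i hij (hi ▸ hv)
  · exact hne (hi ▸ hj)
  · exact h j hij (hj ▸ hw)

lemma exists_mem_branch (φ : V → V) (u : V) : ∃ v ∈ core φ, u ∈ branch φ v := by
  classical
  have h := exists_iterate_mem_core φ u
  exact ⟨_, Nat.find_spec h, mem_branch.2 ⟨_, rfl, fun j hj => Nat.find_min h hj⟩⟩

lemma sum_univ (φ : V → V) (F : V → M) : ∑ x, F x = ∑ v ∈ core φ, ∑ u ∈ branch φ v, F u := by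
  classical
  have h : (univ : Finset V) = (core φ).biUnion (branch φ) := by
    ext u; simpa using exists_mem_branch φ u
  rw [h, Finset.sum_biUnion]
  exact fun v hv w hw hne => disjoint_branch_of_mem_core hv hw hne

lemma sum_card_branch (φ : V → V) : ∑ v ∈ core φ, (branch φ v).card = Fintype.card V := by
  simpa only [Finset.card_eq_sum_ones, Fintype.card] using (sum_univ φ (fun _ => 1)).symm

lemma deg_of_notMem_core (hv : v ∉ core φ) : deg φ v = 1 + (children φ v).card := by
  unfold deg children
  congr 2
  ext w
  simp only [Finset.mem_filter, Finset.mem_univ, true_and]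
  refine ⟨fun h => ⟨fun hw => hv (h ▸ map_mem_core hw), h⟩, fun h => h.2⟩

lemma deg_of_mem_core (hv : v ∈ core φ) : deg φ v = 2 + (children φ v).card := by
  classical
  obtain ⟨w, hw, hwv⟩ := exists_pred_of_mem_core hv
  have h : (univ.filter fun w => φ w = v) = insert w (children φ v) := by
    ext x
    simp only [Finset.mem_filter, Finset.mem_univ, true_and, Finset.mem_insert, mem_children]
    constructor
    · intro hx
      by_cases hxc : x ∈ core φ
      · exact Or.inl (injOn_core hxc hw (hx.trans hwv.symm))
      · exact Or.inr ⟨hxc, hx⟩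
    · rintro (rfl | h)
      exacts [hwv, h.2]
  have h2 : deg φ v = 1 + (insert w (children φ v)).card := by rw [← h]; unfold deg; congr
  rw [h2, Finset.card_insert_of_notMem]
  · omega
  · simp [mem_children, hw]

lemma sum_core_comp (φ : V → V) (F : V → M) : ∑ v ∈ core φ, F (φ v) = ∑ v ∈ core φ, F v := by
  refine Finset.sum_bij (fun v _ => φ v) (fun v hv => map_mem_core hv)
    (fun v hv w hw h => injOn_core hv hw h) (fun v hv => ?_) (fun _ _ => rfl)
  obtain ⟨w, hw, h⟩ := exists_pred_of_mem_core hv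
  exact ⟨w, hw, h⟩

lemma notMem_core_of_mem_children (hw : w ∈ children φ v) : w ∉ core φ := (mem_children.1 hw).1

lemma map_of_mem_children (hw : w ∈ children φ v) : φ w = v := (mem_children.1 hw).2

end FunctionalGraph

/-- `p` is the parent function of the graph `T` rooted at `r`; the root is encoded as the fixed
point of `p`. -/
structure IsRooting {V : Type*} (T : SimpleGraph V) (r : V) (p : V → V) : Prop where
  map_root : p r = r
  adj_iff : ∀ u v, T.Adj u v ↔ u ≠ v ∧ (p u = v ∨ p v = u)
  exists_iterate_eq : ∀ v, ∃ i, p^[i] v = r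

namespace IsRooting

variable {V : Type*} {T : SimpleGraph V} {r : V} {p : V → V} {v : V}

lemma map_ne (h : IsRooting T r p) (hv : v ≠ r) : p v ≠ v := fun hpv => by
  obtain ⟨i, hi⟩ := h.exists_iterate_eq v
  exact hv (by rwa [iterate_fixed hpv] at hi)

lemma map_map_ne (h : IsRooting T r p) (hv : v ≠ r) : p (p v) ≠ v := fun hpv => by
  have hpr : p v ≠ r := fun hr => hv (by rw [← hpv, hr, h.map_root])
  have key (i : ℕ) : p^[i] v = v ∨ p^[i] v = p v := by
    induction i with
    | zero => exact Or.inl rfl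
    | succ i ih =>
      rw [iterate_succ_apply']
      rcases ih with ih | ih <;> simp [ih, hpv]
  obtain ⟨i, hi⟩ := h.exists_iterate_eq v
  rcases key i with hv' | hv' <;> rw [hi] at hv'
  exacts [hv hv'.symm, hpr hv'.symm]

lemma adj_map (h : IsRooting T r p) (hv : v ≠ r) : T.Adj v (p v) :=
  (h.adj_iff _ _).2 ⟨(h.map_ne hv).symm, Or.inl rfl⟩

lemma connected (h : IsRooting T r p) : T.Connected := by
  refine (SimpleGraph.connected_iff_exists_forall_reachable T).2 ⟨r, fun v => ?_⟩
  obtain ⟨i, hi⟩ := h.exists_iterate_eq v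
  induction i generalizing v with
  | zero => exact hi ▸ .rfl
  | succ i ih =>
    by_cases hv : v = r
    · exact hv ▸ .rfl
    · exact (ih (p v) hi).trans (h.adj_map hv).symm.reachable

lemma isTree [Finite V] (h : IsRooting T r p) : T.IsTree := by
  have hedges : T.edgeSet ⊆ (fun v => s(v, p v)) '' {r}ᶜ := by
    intro e he
    induction e with | _ a b
    obtain ⟨hne, rfl | rfl⟩ := (h.adj_iff a b).1 he
    · exact ⟨a, fun hr => hne (by rw [Set.mem_singleton_iff.1 hr, h.map_root]), rfl⟩
    · exact ⟨b, fun hr => hne (by rw [Set.mem_singleton_iff.1 hr, h.map_root]), Sym2.eq_swap⟩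
  have hcard : T.edgeSet.ncard ≤ ({r}ᶜ : Set V).ncard :=
    (Set.ncard_le_ncard hedges).trans Set.ncard_image_le
  have hcompl := Set.ncard_add_ncard_compl ({r} : Set V)
  rw [Set.ncard_singleton] at hcompl
  have hle := h.connected.card_vert_le_card_edgeSet_add_one
  rw [SimpleGraph.isTree_iff_connected_and_card]
  rw [Nat.card_coe_set_eq] at hle ⊢
  exact ⟨h.connected, by omega⟩

end IsRooting

lemma exists_isRooting_of_isTree {V : Type*} {T : SimpleGraph V} (hT : T.IsTree) (r : V) :
    ∃ p, IsRooting T r p := by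
  choose f hf huniq using (hT.existsUnique_path · r)
  refine ⟨fun v => (f v).snd, ?_, fun u v => ⟨fun hadj => ⟨hadj.ne, ?_⟩, ?_⟩, fun v => ?_⟩
  · rw [← huniq r .nil .nil]
    rfl
  · by_cases hv : v ∈ (f u).support
    · exact Or.inl (hT.isAcyclic.eq_snd_of_adj_start (hf u) hadj hv).symm
    · have hcons : (SimpleGraph.Walk.cons hadj.symm (f u)).IsPath := (hf u).cons hv
      exact Or.inr (by rw [← huniq v _ hcons, SimpleGraph.Walk.snd_cons])
  · have hadj_snd {v : V} (hv : v ≠ (f v).snd) : T.Adj v (f v).snd :=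
      (f v).adj_snd fun hnil => hv (hnil.eq.trans ((f v).getVert_of_length_le
        (SimpleGraph.Walk.length_eq_zero_iff.2 hnil ▸ zero_le_one)).symm)
    rintro ⟨hne, rfl | rfl⟩
    exacts [hadj_snd hne, (hadj_snd hne.symm).symm]
  · induction hn : (f v).length generalizing v with
    | zero => exact ⟨0, SimpleGraph.Walk.eq_of_length_eq_zero hn⟩
    | succ n ih =>
      have hnil : ¬ (f v).Nil := fun h => by
        simp [SimpleGraph.Walk.length_eq_zero_iff.2 h] at hn
      have htail : (f v).tail = f (f v).snd := huniq _ _ (hf v).tail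
      have hlen := SimpleGraph.Walk.length_tail_add_one hnil
      obtain ⟨i, hi⟩ := ih (f v).snd (by rw [← htail]; omega)
      exact ⟨i + 1, hi⟩

/-- `φ` orients each edge of the graph `G` so that every vertex has out-degree one and all the
orbits run into one and the same cycle. -/
structure IsOrientation {V : Type*} (G : SimpleGraph V) (φ : V → V) : Prop where
  adj_iff : ∀ u v, G.Adj u v ↔ φ u = v ∨ φ v = u
  map_map_ne : ∀ v, φ (φ v) ≠ v
  exists_iterate_eq : ∃ r, ∀ v, ∃ i, φ^[i] v = r

/-- The contribution of an edge with ends of degrees `a` and `b` to the augmented Zagreb index. -/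
noncomputable def edgeWeight (a b : ℝ) : ℝ := (a * b / (a + b - 2)) ^ 3

namespace IsOrientation

open FunctionalGraph

variable {V : Type*} {G : SimpleGraph V} {φ : V → V} {u v : V}

lemma map_ne (h : IsOrientation G φ) (v : V) : φ v ≠ v := fun hv =>
  h.map_map_ne v (by rw [hv, hv])

lemma adj_map (h : IsOrientation G φ) (v : V) : G.Adj v (φ v) := (h.adj_iff _ _).2 (Or.inl rfl)

open Classical in
lemma card_orbit (h : IsOrientation G φ) (v : V) : ({v, φ v, φ (φ v)} : Finset V).card = 3 :=
  Finset.card_eq_three.2 ⟨_, _, _, (h.map_ne v).symm, (h.map_map_ne v).symm,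
    (h.map_ne (φ v)).symm, rfl⟩

lemma injective_edge (h : IsOrientation G φ) : Injective fun v => s(v, φ v) := by
  intro u v huv
  rcases Sym2.eq_iff.1 huv with h1 | ⟨h1, h2⟩
  · exact h1.1
  · exact absurd (by rw [h2, ← h1]) (h.map_map_ne u)

lemma range_edge (h : IsOrientation G φ) : Set.range (fun v => s(v, φ v)) = G.edgeSet := by
  ext e
  induction e with | _ a b
  rw [SimpleGraph.mem_edgeSet, h.adj_iff]
  constructor
  · rintro ⟨v, hv⟩
    rcases Sym2.eq_iff.1 hv with ⟨rfl, rfl⟩ | ⟨rfl, rfl⟩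
    exacts [Or.inl rfl, Or.inr rfl]
  · rintro (rfl | rfl)
    exacts [⟨a, rfl⟩, ⟨b, Sym2.eq_swap⟩]

lemma reachable_iterate (h : IsOrientation G φ) (v : V) (i : ℕ) : G.Reachable v (φ^[i] v) := by
  induction i with
  | zero => rfl
  | succ i ih => rw [iterate_succ_apply']; exact ih.trans (h.adj_map _).reachable

lemma connected (h : IsOrientation G φ) : G.Connected := by
  obtain ⟨r, hr⟩ := h.exists_iterate_eq
  refine (SimpleGraph.connected_iff_exists_forall_reachable G).2 ⟨r, fun v => ?_⟩
  obtain ⟨i, rfl⟩ := hr v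
  exact (h.reachable_iterate v i).symm

lemma isUnicyclic (h : IsOrientation G φ) : IsUnicyclic G := by
  refine ⟨h.connected, ?_⟩
  rw [← h.range_edge, ← Set.image_univ, Set.ncard_image_of_injective _ h.injective_edge,
    Set.ncard_univ]

variable [Fintype V]

open Classical in
lemma degree_eq (h : IsOrientation G φ) (v : V) : G.degree v = deg φ v := by
  have hn : G.neighborFinset v = insert (φ v) (univ.filter fun w => φ w = v) := by
    ext w
    simp [h.adj_iff, eq_comm]
  rw [← SimpleGraph.card_neighborFinset_eq_degree, hn, card_insert_of_notMem, deg, add_comm]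
  simpa using h.map_map_ne v

lemma augmentedZagrebIndex_eq (h : IsOrientation G φ) :
    augmentedZagrebIndex G = ∑ v, edgeWeight (deg φ v) (deg φ (φ v)) := by
  classical
  refine (Finset.sum_bij (fun v _ => s(v, φ v)) (fun v _ => ?_)
    (fun u _ v _ huv => h.injective_edge huv) (fun e he => ?_) fun v _ => ?_).symm
  · simpa using h.adj_map v
  · rw [SimpleGraph.mem_edgeFinset, ← h.range_edge] at he
    simpa using he
  · simp [edgeWeight, h.degree_eq]

lemma exists_iterate_eq_of_mem_core (h : IsOrientation G φ) (u : V) (hv : v ∈ core φ) :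
    ∃ i, φ^[i] u = v := by
  obtain ⟨r, hr⟩ := h.exists_iterate_eq
  obtain ⟨i, hi⟩ := hr u
  obtain ⟨j, hj⟩ := hr v
  obtain ⟨m, hm, hp⟩ := mem_core.1 hv
  have hjm : φ^[j * m] v = v := hp.const_mul j
  have hle : j ≤ j * m := Nat.le_mul_of_pos_right j hm
  exact ⟨j * m - j + i, by
    rw [iterate_add_apply, hi, ← hj, ← iterate_add_apply, Nat.sub_add_cancel hle, hjm]⟩

lemma isTree_induce_compl_branch (h : IsOrientation G φ) (hv : v ∈ core φ) :
    (G.induce {x | x ∉ branch φ v}).IsTree := by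
  classical
  obtain ⟨ρ, hρ, hρv⟩ := exists_pred_of_mem_core hv
  have hρ_notMem : ρ ∉ branch φ v := by
    rw [mem_branch_iff_of_mem_core hv hρ]
    rintro rfl
    exact h.map_ne ρ hρv
  have hmap {x : V} (hx : x ∉ branch φ v) (hne : x ≠ ρ) : φ x ∉ branch φ v := by
    intro hmem
    by_cases hxc : x ∈ core φ
    · rw [mem_branch_iff_of_mem_core hv (map_mem_core hxc)] at hmem
      exact hne (injOn_core hxc hρ (hmem.trans hρv.symm))
    · exact hx (mem_branch_of_map_mem_branch hmem hxc)
  let p : {x | x ∉ branch φ v} → {x | x ∉ branch φ v} := fun x =>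
    if hx : x.1 = ρ then x else ⟨φ x, hmap x.2 hx⟩
  have hp_root (x : {x | x ∉ branch φ v}) (hx : x.1 = ρ) : p x = x := dif_pos hx
  have hp (x : {x | x ∉ branch φ v}) (hx : x.1 ≠ ρ) : (p x).1 = φ x := by simp [p, hx]
  have hp_iff (x y : {x | x ∉ branch φ v}) (hne : x ≠ y) : p x = y ↔ φ x = y := by
    by_cases hx : x.1 = ρ
    · rw [hp_root x hx, hx, hρv]
      exact iff_of_false hne fun hy => y.2 (hy ▸ self_mem_branch v)
    · rw [← hp x hx, Subtype.ext_iff]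
  refine IsRooting.isTree (r := ⟨ρ, hρ_notMem⟩) (p := p) ⟨hp_root _ rfl, fun x y => ?_, fun x => ?_⟩
  · have hadj : (G.induce {x | x ∉ branch φ v}).Adj x y ↔ φ x = y ∨ φ y = x := h.adj_iff x y
    refine ⟨fun hxy => ⟨hxy.ne, ?_⟩, fun ⟨hne, hxy⟩ => ?_⟩
    · rwa [hp_iff x y hxy.ne, hp_iff y x hxy.ne', ← hadj]
    · rwa [hp_iff x y hne, hp_iff y x hne.symm, ← hadj] at hxy
  · obtain ⟨i, hi⟩ := h.exists_iterate_eq_of_mem_core x.1 hρ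
    induction i generalizing x with
    | zero => exact ⟨0, Subtype.ext hi⟩
    | succ i ih =>
      by_cases hx : x.1 = ρ
      · exact ⟨0, Subtype.ext hx⟩
      · obtain ⟨j, hj⟩ := ih (p x) (by rwa [hp x hx])
        exact ⟨j + 1, hj⟩

lemma induce_core (h : IsOrientation G φ) :
    IsOrientation (G.induce (core φ)) (mapsTo_core φ).restrict where
  adj_iff u v := (h.adj_iff u v).trans (by
    simp only [Subtype.ext_iff, Set.MapsTo.val_restrict_apply])
  map_map_ne v hv := h.map_map_ne v (congrArg Subtype.val hv)
  exists_iterate_eq := by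
    obtain ⟨r, -⟩ := h.exists_iterate_eq
    obtain ⟨i, hi⟩ := exists_iterate_mem_core φ r
    refine ⟨⟨_, hi⟩, fun v => ?_⟩
    obtain ⟨j, hj⟩ := h.exists_iterate_eq_of_mem_core v.1 hi
    exact ⟨j, Subtype.ext (by rw [Set.MapsTo.coe_iterate_restrict, hj])⟩

lemma not_isTree {V : Type*} [Finite V] {G : SimpleGraph V} {φ : V → V} (h : IsOrientation G φ) :
    ¬ G.IsTree := fun hT => by
  have hcard := (SimpleGraph.isTree_iff_connected_and_card.1 hT).2
  rw [Nat.card_coe_set_eq, h.isUnicyclic.2] at hcard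
  omega

lemma exists_mem_core_of_isAcyclic_induce (h : IsOrientation G φ) {X : Finset V}
    (hX : (G.induce {v | v ∉ X}).IsAcyclic) : ∃ v ∈ core φ, v ∈ X := by
  by_contra! hdisj
  have hcore := hX.embedding (SimpleGraph.induceHomOfLE G hdisj)
  exact h.induce_core.not_isTree ⟨h.induce_core.connected, hcore⟩

lemma exists_branch_subset (h : IsOrientation G φ) {X : Finset V}
    (hX : (G.induce {v | v ∉ X}).IsTree) : ∃ v ∈ core φ, branch φ v ⊆ X := by
  obtain ⟨v, hv, hvX⟩ := h.exists_mem_core_of_isAcyclic_induce hX.isAcyclic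
  by_cases hsub : branch φ v ⊆ X
  · exact ⟨v, hv, hsub⟩
  obtain ⟨x, hx, hxX⟩ := Finset.not_subset.1 hsub
  -- The connected graph `G - X` meets the tree hanging at `v` but avoids `v`, so it lies inside.
  have hall (y : {v | v ∉ X}) : y.1 ∈ branch φ v := by
    have hxy := hX.connected ⟨x, hxX⟩ y
    rw [SimpleGraph.reachable_iff_reflTransGen] at hxy
    induction hxy with
    | refl => exact hx
    | @tail y z _ hyz ih =>
      have hyv : y.1 ≠ v := fun hyv => y.2 (hyv ▸ hvX)
      rcases (h.adj_iff y.1 z.1).1 hyz with hyz | hzy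
      · exact hyz ▸ map_mem_branch ih hyv
      · refine mem_branch_of_map_mem_branch (hzy ▸ ih) fun hzc => hyv ?_
        exact (mem_branch_iff_of_mem_core hv (hzy ▸ map_mem_core hzc)).1 ih
  refine ⟨φ v, map_mem_core hv, fun y hy => ?_⟩
  by_contra hyX
  exact Finset.disjoint_left.1
    (disjoint_branch_of_mem_core hv (map_mem_core hv) (h.map_ne v).symm) (hall ⟨y, hyX⟩) hy

lemma isApexTree_iff (h : IsOrientation G φ) (k : ℕ) : IsApexTree k G ↔
    (∀ v ∈ core φ, k ≤ (branch φ v).card) ∧ ∃ v ∈ core φ, (branch φ v).card = k := by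
  constructor
  · rintro ⟨-, ⟨X, hXk, hX⟩, hmin⟩
    have hge : ∀ v ∈ core φ, k ≤ (branch φ v).card := fun v hv => by
      by_contra! hlt
      exact hmin _ hlt (h.isTree_induce_compl_branch hv)
    obtain ⟨v, hv, hsub⟩ := h.exists_branch_subset hX
    exact ⟨hge, v, hv, le_antisymm (hXk ▸ Finset.card_le_card hsub) (hge v hv)⟩
  · rintro ⟨hge, v, hv, hk⟩
    refine ⟨h.connected, ⟨_, hk, h.isTree_induce_compl_branch hv⟩, fun X hXk hX => ?_⟩
    obtain ⟨w, hw, hsub⟩ := h.exists_branch_subset hX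
    have := Finset.card_le_card hsub
    have := hge w hw
    omega

lemma core_nonempty (h : IsOrientation G φ) : (core φ).Nonempty := by
  obtain ⟨r, -⟩ := h.exists_iterate_eq
  obtain ⟨i, hi⟩ := exists_iterate_mem_core φ r
  exact ⟨_, hi⟩

lemma three_le_card_core (h : IsOrientation G φ) : 3 ≤ (core φ).card := by
  classical
  obtain ⟨v, hv⟩ := h.core_nonempty
  rw [← h.card_orbit v]
  refine Finset.card_le_card ?_
  simp [insert_subset_iff, hv, map_mem_core]

end IsOrientation

lemma IsUnicyclic.exists_isTree_sup_edge {V : Type*} [Finite V] {G : SimpleGraph V}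
    (hG : IsUnicyclic G) : ∃ (T : SimpleGraph V) (x y : V), T.IsTree ∧ x ≠ y ∧ ¬ T.Adj x y ∧
      G = T ⊔ SimpleGraph.edge x y := by
  obtain ⟨hconn, hcard⟩ := hG
  obtain ⟨T, hTG, hT⟩ := hconn.exists_isTree_le
  have hTcard := (SimpleGraph.isTree_iff_connected_and_card.1 hT).2
  rw [Nat.card_coe_set_eq] at hTcard
  have hsub : T.edgeSet ⊆ G.edgeSet := SimpleGraph.edgeSet_subset_edgeSet.2 hTG
  obtain ⟨e, he⟩ : ∃ e, G.edgeSet \ T.edgeSet = {e} := by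
    rw [← Set.ncard_eq_one, Set.ncard_sdiff hsub]
    omega
  induction e with | _ x y
  obtain ⟨hGxy, hTxy⟩ : s(x, y) ∈ G.edgeSet \ T.edgeSet := he ▸ rfl
  refine ⟨T, x, y, hT, hGxy.ne, hTxy, SimpleGraph.edgeSet_injective ?_⟩
  rw [SimpleGraph.edgeSet_sup, SimpleGraph.edgeSet_edge_of_ne hGxy.ne,
    ← he, Set.union_sdiff_cancel hsub]

lemma IsRooting.isOrientation {V : Type*} [DecidableEq V] {T : SimpleGraph V} {x y : V} {p : V → V}
    (h : IsRooting T x p) (hxy : x ≠ y) (hadj : ¬ T.Adj x y) :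
    IsOrientation (T ⊔ SimpleGraph.edge x y) (update p x y) where
  adj_iff u v := by
    have hroot := h.map_root
    have hne (w : V) (hw : w ≠ x) : p w ≠ w := h.map_ne hw
    rw [SimpleGraph.sup_adj, h.adj_iff, SimpleGraph.edge_adj]
    grind
  map_map_ne v hv := by
    rcases eq_or_ne v x with rfl | hvx
    · rw [update_self, update_of_ne hxy.symm] at hv
      exact hadj (hv ▸ (h.adj_map hxy.symm).symm)
    rw [update_of_ne hvx] at hv
    rcases eq_or_ne (p v) x with hpv | hpv
    · rw [hpv, update_self] at hv
      exact hadj (hpv ▸ hv ▸ (h.adj_map hvx).symm)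
    · rw [update_of_ne hpv] at hv
      exact h.map_map_ne hvx hv
  exists_iterate_eq := by
    refine ⟨x, fun v => ?_⟩
    obtain ⟨i, hi⟩ := h.exists_iterate_eq v
    induction i generalizing v with
    | zero => exact ⟨0, hi⟩
    | succ i ih =>
      rcases eq_or_ne v x with rfl | hvx
      · exact ⟨0, rfl⟩
      · obtain ⟨j, hj⟩ := ih (p v) hi
        exact ⟨j + 1, by rwa [iterate_succ_apply, update_of_ne hvx]⟩

lemma IsUnicyclic.exists_isOrientation {V : Type*} [Finite V] {G : SimpleGraph V}
    (hG : IsUnicyclic G) : ∃ φ, IsOrientation G φ := by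
  classical
  obtain ⟨T, x, y, hT, hxy, hadj, rfl⟩ := hG.exists_isTree_sup_edge
  obtain ⟨p, hp⟩ := exists_isRooting_of_isTree hT x
  exact ⟨_, hp.isOrientation hxy hadj⟩

lemma edgeWeight_comm (a b : ℝ) : edgeWeight a b = edgeWeight b a := by
  rw [edgeWeight, edgeWeight, mul_comm, add_comm]

lemma edgeWeight_two_left {b : ℝ} (hb : 0 < b) : edgeWeight 2 b = 8 := by
  rw [edgeWeight, add_sub_cancel_left, mul_div_cancel_right₀ _ hb.ne']
  norm_num

lemma edgeWeight_three_three : edgeWeight 3 3 = 729 / 64 := by norm_num [edgeWeight]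

section Monotonicity

variable {a a' b b' : ℝ}

lemma mul_div_add_sub_two_mono_left (ha : 2 ≤ a) (haa' : a ≤ a') (hb : 2 ≤ b) :
    a * b / (a + b - 2) ≤ a' * b / (a' + b - 2) := by
  rw [div_le_div_iff₀ (by linarith) (by linarith)]
  nlinarith [mul_nonneg (sub_nonneg.2 haa') (mul_nonneg (by linarith : 0 ≤ b) (sub_nonneg.2 hb))]

lemma mul_div_add_sub_two_supermodular (ha : 2 ≤ a) (haa' : a ≤ a') (hb : 2 ≤ b) (hbb' : b ≤ b') :
    a' * b / (a' + b - 2) - a * b / (a + b - 2) ≤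
      a' * b' / (a' + b' - 2) - a * b' / (a + b' - 2) := by
  have hsub {c : ℝ} (hc : 2 ≤ c) : a' * c / (a' + c - 2) - a * c / (a + c - 2) =
      (a' - a) * (c / (a' + c - 2)) * ((c - 2) / (a + c - 2)) := by
    have h : a + c - 2 ≠ 0 := by linarith
    have h' : a' + c - 2 ≠ 0 := by linarith
    field_simp
    ring
  rw [hsub hb, hsub (hb.trans hbb')]
  have h₁ : b / (a' + b - 2) ≤ b' / (a' + b' - 2) := by
    rw [div_le_div_iff₀ (by linarith) (by linarith)]
    nlinarith
  have h₂ : (b - 2) / (a + b - 2) ≤ (b' - 2) / (a + b' - 2) := by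
    rw [div_le_div_iff₀ (by linarith) (by linarith)]
    nlinarith
  have h₃ : 0 ≤ (b - 2) / (a + b - 2) := div_nonneg (by linarith) (by linarith)
  have h₄ : 0 ≤ b' / (a' + b' - 2) := div_nonneg (by linarith) (by linarith)
  have : 0 ≤ a' - a := sub_nonneg.2 haa'
  gcongr

lemma edgeWeight_mono (ha : 2 ≤ a) (haa' : a ≤ a') (hb : 2 ≤ b) (hbb' : b ≤ b') :
    edgeWeight a b ≤ edgeWeight a' b' := by
  have h : a * b / (a + b - 2) ≤ a' * b' / (a' + b' - 2) := calc
    a * b / (a + b - 2) ≤ a' * b / (a' + b - 2) := mul_div_add_sub_two_mono_left ha haa' hb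
    _ = b * a' / (b + a' - 2) := by rw [mul_comm, add_comm a']
    _ ≤ b' * a' / (b' + a' - 2) := mul_div_add_sub_two_mono_left hb hbb' (ha.trans haa')
    _ = a' * b' / (a' + b' - 2) := by rw [mul_comm, add_comm a']
  exact pow_le_pow_left₀ (div_nonneg (by nlinarith) (by linarith)) h 3

lemma eight_le_edgeWeight (ha : 2 ≤ a) (hb : 2 ≤ b) : 8 ≤ edgeWeight a b := by
  rw [← edgeWeight_two_left (by linarith : 0 < b)]
  exact edgeWeight_mono le_rfl ha hb le_rfl

lemma pow_three_add_pow_three_le {p q r s : ℝ} (hp : 0 ≤ p) (hpq : p ≤ q) (hpr : p ≤ r)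
    (h : q - p ≤ s - r) : q ^ 3 + r ^ 3 ≤ p ^ 3 + s ^ 3 := by
  have hs : (q + r - p) ^ 3 ≤ s ^ 3 := pow_le_pow_left₀ (by linarith) (by linarith) 3
  nlinarith [mul_nonneg (mul_nonneg (sub_nonneg.2 hpq) (sub_nonneg.2 hpr))
    (by linarith : 0 ≤ q + r)]

lemma edgeWeight_supermodular (ha : 2 ≤ a) (haa' : a ≤ a') (hb : 2 ≤ b) (hbb' : b ≤ b') :
    edgeWeight a' b + edgeWeight a b' ≤ edgeWeight a b + edgeWeight a' b' := by
  refine pow_three_add_pow_three_le (div_nonneg (by nlinarith) (by linarith))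
    (mul_div_add_sub_two_mono_left ha haa' hb) ?_
    (mul_div_add_sub_two_supermodular ha haa' hb hbb')
  rw [mul_comm a b, mul_comm a b', add_comm a b, add_comm a b']
  exact mul_div_add_sub_two_mono_left hb hbb' ha

end Monotonicity

/-- The mixed second difference of `edgeWeight` with base point `(3, 3)`; supermodularity of the
weight makes it nonnegative. -/
noncomputable def interaction (a b : ℝ) : ℝ :=
  edgeWeight a b + edgeWeight 3 3 - edgeWeight 3 a - edgeWeight 3 b

lemma interaction_comm (a b : ℝ) : interaction a b = interaction b a := by
  rw [interaction, interaction, edgeWeight_comm a b]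
  ring

lemma interaction_three_left (b : ℝ) : interaction 3 b = 0 := by rw [interaction]; ring

lemma interaction_mono_left {a a' b : ℝ} (ha : 3 ≤ a) (haa' : a ≤ a') (hb : 3 ≤ b) :
    interaction a b ≤ interaction a' b := by
  have h := edgeWeight_supermodular (by linarith) haa' (by norm_num) hb
  rw [edgeWeight_comm a', edgeWeight_comm a 3] at h
  rw [interaction, interaction]
  linarith

lemma interaction_mono {a a' b b' : ℝ} (ha : 3 ≤ a) (haa' : a ≤ a') (hb : 3 ≤ b) (hbb' : b ≤ b') :
    interaction a b ≤ interaction a' b' := by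
  refine (interaction_mono_left ha haa' hb).trans ?_
  rw [interaction_comm a', interaction_comm a']
  exact interaction_mono_left hb hbb' (ha.trans haa')

lemma interaction_nonneg {a b : ℝ} (ha : 3 ≤ a) (hb : 3 ≤ b) : 0 ≤ interaction a b := by
  rw [← interaction_three_left b]
  exact interaction_mono_left le_rfl ha hb

/-- The part of `x * ((x + 1) / x) ^ 3 = x + 3 + tail x` that vanishes at infinity: the pendant
edges at a vertex with `x` pendant neighbours and one further neighbour have total weight
`x + 3 + tail x`. -/
noncomputable def tail (x : ℝ) : ℝ := 3 / x + 1 / x ^ 2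

lemma tail_nonneg {x : ℝ} (hx : 0 ≤ x) : 0 ≤ tail x := by unfold tail; positivity

lemma tail_anti {x y : ℝ} (hx : 0 < x) (h : x ≤ y) : tail y ≤ tail x := by
  unfold tail; gcongr

namespace FunctionalGraph

variable {V : Type*} [Fintype V] {φ : V → V} {u v w : V}

/-- The tree hanging at `v` is a star with center `v` (possibly the single vertex `v`). -/
def IsCenterStarAt (φ : V → V) (v : V) : Prop := ∀ w ∈ children φ v, children φ w = ∅

/-- The tree hanging at `v` is a star with at least two edges of which `v` is a pendant vertex. -/
def IsLeafStarAt (φ : V → V) (v : V) : Prop :=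
  ∃ w, children φ v = {w} ∧ (children φ w).Nonempty ∧ IsCenterStarAt φ w

/-- The tree hanging at `v` is a `zTree` of which `v` is the special pendant vertex. -/
def IsZTreeAt (φ : V → V) (v : V) : Prop := ∃ w, children φ v = {w} ∧ IsLeafStarAt φ w

/-- The total weight of the edges `u (φ u)` with `u` in the tree hanging at `v`, minus the number
of vertices of that tree. -/
noncomputable def excess (φ : V → V) (v : V) : ℝ :=
  ∑ u ∈ branch φ v, (edgeWeight (deg φ u) (deg φ (φ u)) - 1)

lemma excess_eq (φ : V → V) (v : V) : excess φ v =
    edgeWeight (deg φ v) (deg φ (φ v)) - 1 + ∑ w ∈ children φ v, excess φ w :=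
  sum_branch _ v

lemma two_le_deg_of_mem_children (hw : w ∈ children φ v) : 2 ≤ deg φ v := by
  have hpos : 0 < (children φ v).card := card_pos.2 ⟨w, hw⟩
  by_cases hv : v ∈ core φ
  · rw [deg_of_mem_core hv]; omega
  · rw [deg_of_notMem_core hv]; omega

lemma two_le_deg_map (hw : w ∉ core φ) : 2 ≤ deg φ (φ w) :=
  two_le_deg_of_mem_children (mem_children.2 ⟨hw, rfl⟩)

lemma three_le_deg (hv : v ∈ core φ) (h : (children φ v).Nonempty) : 3 ≤ deg φ v := by
  have := h.card_pos
  rw [deg_of_mem_core hv]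
  omega

lemma card_branch_eq_one_iff : (branch φ v).card = 1 ↔ children φ v = ∅ := by
  rw [card_branch, add_eq_left, sum_eq_zero_iff, eq_empty_iff_forall_notMem]
  exact forall₂_congr fun w _ => iff_false_intro (card_branch_pos w).ne'

lemma nonempty_children_iff : (children φ v).Nonempty ↔ 2 ≤ (branch φ v).card := by
  have := card_branch_pos (φ := φ) v
  rw [nonempty_iff_ne_empty, Ne, ← card_branch_eq_one_iff]
  omega

lemma IsCenterStarAt.card_branch (h : IsCenterStarAt φ v) :
    (branch φ v).card = 1 + (children φ v).card := by
  rw [FunctionalGraph.card_branch, card_eq_sum_ones (children φ v)]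
  congr 1
  exact sum_congr rfl fun w hw => card_branch_eq_one_iff.2 (h w hw)

lemma card_branch_of_children_eq_singleton (h : children φ v = {w}) :
    (branch φ v).card = (branch φ w).card + 1 := by
  rw [card_branch, h, sum_singleton, add_comm]

lemma excess_of_children_eq_empty (hw : w ∉ core φ) (h : children φ w = ∅) :
    excess φ w = ((deg φ (φ w) : ℝ) / (deg φ (φ w) - 1)) ^ 3 - 1 := by
  rw [excess_eq, h, deg_of_notMem_core hw, h, card_empty, sum_empty, edgeWeight]
  push_cast
  ring_nf

lemma excess_nonneg (hw : w ∉ core φ) : 0 ≤ excess φ w := by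
  induction w using children_induction (φ := φ) with | _ v ih
  have hp : (2 : ℝ) ≤ deg φ (φ v) := by exact_mod_cast two_le_deg_map hw
  obtain h | ⟨c, hc⟩ := (children φ v).eq_empty_or_nonempty
  · rw [excess_of_children_eq_empty hw h, sub_nonneg]
    exact one_le_pow₀ (by rw [le_div_iff₀ (by linarith)]; linarith)
  · have hd : (2 : ℝ) ≤ deg φ v := by exact_mod_cast two_le_deg_of_mem_children hc
    have h8 := eight_le_edgeWeight hd hp
    have hsum : 0 ≤ ∑ w ∈ children φ v, excess φ w :=
      sum_nonneg fun w hw => ih w hw (notMem_core_of_mem_children hw)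
    rw [excess_eq]
    linarith

lemma excess_le_sum_children (hw : w ∈ children φ v) :
    excess φ w ≤ ∑ u ∈ children φ v, excess φ u :=
  single_le_sum (f := excess φ) (fun _ hu => excess_nonneg (notMem_core_of_mem_children hu)) hw

lemma sum_excess_children (h : IsCenterStarAt φ v) :
    ∑ w ∈ children φ v, excess φ w =
      (children φ v).card * (((deg φ v : ℝ) / (deg φ v - 1)) ^ 3 - 1) := by
  rw [← nsmul_eq_mul, ← sum_const]
  refine sum_congr rfl fun w hw => ?_
  rw [excess_of_children_eq_empty (notMem_core_of_mem_children hw) (h w hw),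
    map_of_mem_children hw]

lemma excess_of_isCenterStarAt (hw : w ∉ core φ) (hne : (children φ w).Nonempty)
    (h : IsCenterStarAt φ w) : excess φ w =
      edgeWeight (branch φ w).card (deg φ (φ w)) + 2 + tail ((branch φ w).card - 1) := by
  rw [excess_eq, sum_excess_children h, h.card_branch, deg_of_notMem_core hw]
  have : (0 : ℝ) < (children φ w).card := by exact_mod_cast hne.card_pos
  push_cast
  rw [add_sub_cancel_left, tail]
  field_simp
  ring

lemma excess_of_isLeafStarAt (hw : w ∉ core φ) (h : IsLeafStarAt φ w) :
    excess φ w = 17 + tail ((branch φ w).card - 2) := by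
  obtain ⟨c, hwc, hne, hc⟩ := h
  have hcw : c ∈ children φ w := hwc ▸ mem_singleton_self c
  have hp : (2 : ℝ) ≤ deg φ (φ w) := by exact_mod_cast two_le_deg_map hw
  have hpos : (0 : ℝ) < (branch φ c).card := by exact_mod_cast card_branch_pos c
  have hd : deg φ w = 2 := by rw [deg_of_notMem_core hw, hwc, card_singleton]
  rw [excess_eq, hwc, sum_singleton,
    excess_of_isCenterStarAt (notMem_core_of_mem_children hcw) hne hc,
    map_of_mem_children hcw, hd, card_branch_of_children_eq_singleton hwc, Nat.cast_two,
    edgeWeight_two_left (by linarith), edgeWeight_comm, edgeWeight_two_left hpos]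
  push_cast
  ring_nf

lemma exists_mem_children_of_not_isCenterStarAt (h : ¬ IsCenterStarAt φ v) :
    ∃ w ∈ children φ v, (children φ w).Nonempty := by
  simpa only [IsCenterStarAt, not_forall, exists_prop, ← nonempty_iff_ne_empty] using h

lemma ten_add_tail_le_excess (hw : w ∉ core φ) (hne : (children φ w).Nonempty) :
    10 + tail ((branch φ w).card - 1) ≤ excess φ w := by
  induction w using children_induction (φ := φ) with | _ v ih
  have hp : (2 : ℝ) ≤ deg φ (φ v) := by exact_mod_cast two_le_deg_map hw
  by_cases hstar : IsCenterStarAt φ v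
  · have h2 : (2 : ℝ) ≤ (branch φ v).card := by exact_mod_cast nonempty_children_iff.1 hne
    have := eight_le_edgeWeight h2 hp
    rw [excess_of_isCenterStarAt hw hne hstar]
    linarith
  · obtain ⟨c, hc, hcne⟩ := exists_mem_children_of_not_isCenterStarAt hstar
    have hd : (2 : ℝ) ≤ deg φ v := by exact_mod_cast two_le_deg_of_mem_children hc
    have h2 : (2 : ℝ) ≤ (branch φ c).card := by exact_mod_cast nonempty_children_iff.1 hcne
    have hlt : ((branch φ c).card : ℝ) ≤ (branch φ v).card := by
      exact_mod_cast (card_branch_lt_of_mem_children hc).le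
    have htail := tail_anti (x := (branch φ c).card - 1) (by linarith) (sub_le_sub_right hlt 1)
    have hexc := ih c hc (notMem_core_of_mem_children hc) hcne
    have := excess_le_sum_children hc
    have := eight_le_edgeWeight hd hp
    rw [excess_eq]
    linarith

lemma ten_add_tail_le_sum_excess {c : V} (hc : c ∈ children φ w)
    (hne : (children φ c).Nonempty) :
    10 + tail ((branch φ w).card - 2) ≤ ∑ u ∈ children φ w, excess φ u := by
  have h2 : (2 : ℝ) ≤ (branch φ c).card := by exact_mod_cast nonempty_children_iff.1 hne
  have hlt : ((branch φ c).card : ℝ) + 1 ≤ (branch φ w).card := by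
    exact_mod_cast card_branch_lt_of_mem_children hc
  have htail := tail_anti (x := (branch φ c).card - 1) (y := (branch φ w).card - 2)
    (by linarith) (by linarith)
  have := ten_add_tail_le_excess (notMem_core_of_mem_children hc) hne
  have := excess_le_sum_children hc
  linarith

lemma seventeen_add_tail_le_excess (hw : w ∉ core φ) (h : ¬ IsCenterStarAt φ w) :
    17 + tail ((branch φ w).card - 2) ≤ excess φ w := by
  obtain ⟨c, hc, hne⟩ := exists_mem_children_of_not_isCenterStarAt h
  have hd : (2 : ℝ) ≤ deg φ w := by exact_mod_cast two_le_deg_of_mem_children hc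
  have hp : (2 : ℝ) ≤ deg φ (φ w) := by exact_mod_cast two_le_deg_map hw
  have := eight_le_edgeWeight hd hp
  have := ten_add_tail_le_sum_excess hc hne
  rw [excess_eq]
  linarith

end FunctionalGraph

/-- The three kinds of trees that hang at the triangle of an extremal graph; each is named after
the rooted tree that it stands for. -/
inductive BranchShape
  | centerStar
  | leafStar
  | zTree

namespace BranchShape

/-- The value of `FunctionalGraph.charge` at a cycle vertex at which a tree of the given shape with
`s` vertices hangs. -/
noncomputable def charge : BranchShape → ℕ → ℝ
  | centerStar, s => 2 * edgeWeight 3 (s + 1) - edgeWeight 3 3 + 2 - 2 / s ^ 2 - 1 / s ^ 3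
  | leafStar, s => edgeWeight 3 3 + edgeWeight (s - 1) 3 + 1 + tail (s - 2)
  | zTree, s => edgeWeight 3 3 + 16 + tail (s - 3)

variable {s t : ℕ}

lemma charge_centerStar_mono (hs : 1 ≤ s) (hst : s ≤ t) :
    centerStar.charge s ≤ centerStar.charge t := by
  have hs' : (1 : ℝ) ≤ s := by exact_mod_cast hs
  have hst' : (s : ℝ) ≤ t := by exact_mod_cast hst
  have := edgeWeight_mono (a := 3) (b := s + 1) (b' := t + 1) (by norm_num) le_rfl (by linarith)
    (by linarith)
  have : 2 / (t : ℝ) ^ 2 ≤ 2 / s ^ 2 := by gcongr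
  have : 1 / (t : ℝ) ^ 3 ≤ 1 / s ^ 3 := by gcongr
  unfold charge
  linarith

lemma charge_zTree_anti (hs : 4 ≤ s) (hst : s ≤ t) : zTree.charge t ≤ zTree.charge s := by
  have hs' : (4 : ℝ) ≤ s := by exact_mod_cast hs
  have hst' : (s : ℝ) ≤ t := by exact_mod_cast hst
  have := tail_anti (x := s - 3) (y := t - 3) (by linarith) (by linarith)
  unfold charge
  linarith

lemma lt_charge_zTree (hs : 4 ≤ s) : 27.39 < zTree.charge s := by
  have hs' : (4 : ℝ) ≤ s := by exact_mod_cast hs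
  have := tail_nonneg (x := s - 3) (by linarith)
  rw [charge, edgeWeight_three_three]
  linarith

lemma charge_zTree_lt_charge_leafStar (hs : 6 ≤ s) : zTree.charge s < leafStar.charge s := by
  obtain rfl | hs := hs.eq_or_lt
  · norm_num [charge, edgeWeight, tail]
  · have hs' : (7 : ℝ) ≤ s := by exact_mod_cast hs
    have := edgeWeight_mono (a := 6) (a' := s - 1) (b := 3) (by norm_num) (by linarith)
      (by norm_num) le_rfl
    have : edgeWeight 6 3 = (18 / 7) ^ 3 := by norm_num [edgeWeight]
    have := tail_anti (x := 4) (y := s - 3) (by norm_num) (by linarith)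
    have : tail 4 = 13 / 16 := by norm_num [tail]
    have := tail_nonneg (x := s - 2) (by linarith)
    unfold charge
    linarith

lemma charge_leafStar_lt_charge_zTree (hs : s = 4 ∨ s = 5) :
    leafStar.charge s < zTree.charge s := by
  rcases hs with rfl | rfl <;> norm_num [charge, edgeWeight, tail]

lemma charge_zTree_lt_charge_centerStar (hs : 7 ≤ s) :
    zTree.charge s < centerStar.charge s := calc
  zTree.charge s ≤ zTree.charge 7 := charge_zTree_anti (by norm_num) hs
  _ < centerStar.charge 7 := by norm_num [charge, edgeWeight, tail]
  _ ≤ centerStar.charge s := charge_centerStar_mono (by norm_num) hs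

end BranchShape

lemma tail_sub_tail {x y : ℝ} (hx : 0 < x) (hy : 0 < y) :
    tail x - tail y = (y - x) * (3 / (x * y) + 1 / (x * y ^ 2) + 1 / (x ^ 2 * y)) := by
  unfold tail
  field_simp
  ring

lemma tail_add_tail_lt {p q r t : ℝ} (hp : 0 < p) (hpq : p < q) (hqr : q ≤ r)
    (h : p + t = q + r) : tail q + tail r < tail p + tail t := by
  have hq : 0 < q := hp.trans hpq
  have hr : 0 < r := hq.trans_le hqr
  have hrt : t - r = q - p := by linarith
  have hprod : 3 / (r * t) + 1 / (r * t ^ 2) + 1 / (r ^ 2 * t) <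
      3 / (p * q) + 1 / (p * q ^ 2) + 1 / (p ^ 2 * q) := by
    have hpr : p < r := hpq.trans_le hqr
    have hqt : q < t := by linarith
    gcongr
  have := mul_lt_mul_of_pos_left hprod (sub_pos.2 hpq)
  have hpq' := tail_sub_tail hp hq
  have hrt' := tail_sub_tail hr (by linarith : 0 < t)
  rw [hrt] at hrt'
  linarith

lemma BranchShape.charge_zTree_balanced_lt {s t : ℕ} (hs : 4 ≤ s) (hst : s < (s + t) / 2) :
    zTree.charge ((s + t) / 2) + zTree.charge ((s + t + 1) / 2) <
      zTree.charge s + zTree.charge t := by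
  have hs' : (4 : ℝ) ≤ s := by exact_mod_cast hs
  have hlow : (s : ℝ) < ((s + t) / 2 : ℕ) := by exact_mod_cast hst
  have hhigh : (((s + t) / 2 : ℕ) : ℝ) ≤ ((s + t + 1) / 2 : ℕ) := by
    exact_mod_cast (by omega : (s + t) / 2 ≤ (s + t + 1) / 2)
  have hsum : (s : ℝ) + t = ((s + t) / 2 : ℕ) + ((s + t + 1) / 2 : ℕ) := by
    exact_mod_cast (by omega : s + t = (s + t) / 2 + (s + t + 1) / 2)
  have := tail_add_tail_lt (p := s - 3) (q := ((s + t) / 2 : ℕ) - 3)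
    (r := ((s + t + 1) / 2 : ℕ) - 3) (t := t - 3) (by linarith) (by linarith) (by linarith)
    (by linarith)
  unfold charge
  linarith

namespace FunctionalGraph

variable {V : Type*} [Fintype V] {φ : V → V} {v w : V}

/-- The tree hanging at `v` has the given shape. -/
def HasShape (φ : V → V) (v : V) : BranchShape → Prop
  | .centerStar => IsCenterStarAt φ v
  | .leafStar => IsLeafStarAt φ v
  | .zTree => IsZTreeAt φ v

/-- The share in `AZI - n` of the cycle vertex `v` and of the tree hanging at it. The weight of a
cycle edge with ends of degrees `a` and `b` is split as
`(edgeWeight 3 a - edgeWeight 3 3 / 2) + (edgeWeight 3 b - edgeWeight 3 3 / 2) + interaction a b`,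
of which each end takes its bracket, so that only the interactions are left over. -/
noncomputable def charge (φ : V → V) (v : V) : ℝ :=
  2 * edgeWeight 3 (deg φ v) - edgeWeight 3 3 - 1 + ∑ w ∈ children φ v, excess φ w

lemma deg_eq_three_of_children_eq_singleton (hv : v ∈ core φ) (h : children φ v = {w}) :
    deg φ v = 3 := by
  rw [deg_of_mem_core hv, h, card_singleton]

lemma charge_of_children_eq_singleton (hv : v ∈ core φ) (h : children φ v = {w}) :
    charge φ v = edgeWeight 3 3 - 1 + excess φ w := by
  rw [charge, deg_eq_three_of_children_eq_singleton hv h, h, sum_singleton]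
  push_cast
  ring

lemma IsCenterStarAt.deg_eq (h : IsCenterStarAt φ v) (hv : v ∈ core φ) :
    deg φ v = (branch φ v).card + 1 := by
  rw [deg_of_mem_core hv, h.card_branch]
  omega

lemma IsCenterStarAt.charge_eq (h : IsCenterStarAt φ v) (hv : v ∈ core φ) :
    charge φ v = BranchShape.centerStar.charge (branch φ v).card := by
  have hchildren : ((children φ v).card : ℝ) = (branch φ v).card - 1 := by
    rw [h.card_branch]
    push_cast
    ring
  have hpos : (0 : ℝ) < (branch φ v).card := by exact_mod_cast card_branch_pos v
  rw [charge, BranchShape.charge, sum_excess_children h, h.deg_eq hv, hchildren]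
  push_cast
  rw [add_sub_cancel_right]
  field_simp
  ring

lemma IsLeafStarAt.charge_eq (h : IsLeafStarAt φ v) (hv : v ∈ core φ) :
    charge φ v = BranchShape.leafStar.charge (branch φ v).card := by
  obtain ⟨w, hvw, hne, hw⟩ := h
  have hwv : w ∈ children φ v := hvw ▸ mem_singleton_self w
  rw [charge_of_children_eq_singleton hv hvw, BranchShape.charge,
    excess_of_isCenterStarAt (notMem_core_of_mem_children hwv) hne hw, map_of_mem_children hwv,
    deg_eq_three_of_children_eq_singleton hv hvw, card_branch_of_children_eq_singleton hvw]
  push_cast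
  ring_nf

lemma IsZTreeAt.charge_eq (h : IsZTreeAt φ v) (hv : v ∈ core φ) :
    charge φ v = BranchShape.zTree.charge (branch φ v).card := by
  obtain ⟨w, hvw, hw⟩ := h
  have hwv : w ∈ children φ v := hvw ▸ mem_singleton_self w
  rw [charge_of_children_eq_singleton hv hvw, BranchShape.charge,
    excess_of_isLeafStarAt (notMem_core_of_mem_children hwv) hw,
    card_branch_of_children_eq_singleton hvw]
  push_cast
  ring_nf

lemma HasShape.charge_eq {σ : BranchShape} (h : HasShape φ v σ) (hv : v ∈ core φ) :
    charge φ v = σ.charge (branch φ v).card :=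
  match σ, h with
  | .centerStar, h => IsCenterStarAt.charge_eq h hv
  | .leafStar, h => IsLeafStarAt.charge_eq h hv
  | .zTree, h => IsZTreeAt.charge_eq h hv

lemma isLeafStarAt_of_excess_le (hw : w ∉ core φ) (hp : 3 ≤ deg φ (φ w))
    (hstar : ¬ IsCenterStarAt φ w) (h : excess φ w ≤ 17 + tail ((branch φ w).card - 2)) :
    IsLeafStarAt φ w := by
  obtain ⟨c, hc, hne⟩ := exists_mem_children_of_not_isCenterStarAt hstar
  have hd2 := two_le_deg_of_mem_children hc
  rw [excess_eq] at h
  have hd : deg φ w = 2 := by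
    by_contra hd
    have := edgeWeight_mono (a := 3) (a' := deg φ w) (b := 3) (b' := deg φ (φ w)) (by norm_num)
      (by exact_mod_cast (by omega : 3 ≤ deg φ w)) (by norm_num) (by exact_mod_cast hp)
    have := ten_add_tail_le_sum_excess hc hne
    rw [edgeWeight_three_three] at *
    linarith
  obtain ⟨c', hwc⟩ : ∃ c', children φ w = {c'} := by
    rw [← card_eq_one]
    rw [deg_of_notMem_core hw] at hd
    omega
  obtain rfl : c = c' := by simpa only [hwc, mem_singleton] using hc
  refine ⟨c, hwc, hne, ?_⟩
  by_contra hcstar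
  have hcard : (2 : ℝ) ≤ (branch φ c).card := by exact_mod_cast nonempty_children_iff.1 hne
  have htail : tail ((branch φ w).card - 2) ≤ tail 1 := by
    rw [card_branch_of_children_eq_singleton hwc]
    push_cast
    exact tail_anti one_pos (by linarith)
  have : tail 1 = 4 := by norm_num [tail]
  have := eight_le_edgeWeight (a := deg φ w) (b := deg φ (φ w)) (by exact_mod_cast hd2)
    (by exact_mod_cast (by omega : 2 ≤ deg φ (φ w)))
  have := seventeen_add_tail_le_excess (notMem_core_of_mem_children hc) hcstar
  have := tail_nonneg (sub_nonneg.2 hcard)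
  rw [hwc, sum_singleton] at h
  linarith

lemma edgeWeight_three_three_add_two_le_excess (hw : w ∉ core φ) (hne : (children φ w).Nonempty)
    (hp : 3 ≤ deg φ (φ w)) : edgeWeight 3 3 + 2 ≤ excess φ w := by
  have h2 := nonempty_children_iff.1 hne
  by_cases hstar : IsCenterStarAt φ w
  · rw [excess_of_isCenterStarAt hw hne hstar]
    have hp' : (3 : ℝ) ≤ deg φ (φ w) := by exact_mod_cast hp
    obtain h | h := h2.eq_or_lt
    · rw [← h, Nat.cast_two, edgeWeight_two_left (by linarith), edgeWeight_three_three]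
      norm_num [tail]
    · have h3 : (3 : ℝ) ≤ (branch φ w).card := by exact_mod_cast h
      have := edgeWeight_mono (by norm_num) h3 (by norm_num) hp'
      have := tail_nonneg (x := (branch φ w).card - 1) (by linarith)
      linarith
  · have := seventeen_add_tail_le_excess hw hstar
    have := tail_nonneg (x := (branch φ w).card - 2) (sub_nonneg.2 (by exact_mod_cast h2))
    rw [edgeWeight_three_three]
    linarith

lemma lt_charge_of_four_le_deg (hd : 4 ≤ deg φ v) (h : ¬ IsCenterStarAt φ v) :
    BranchShape.zTree.charge 6 < charge φ v := by
  obtain ⟨w, hw, hne⟩ := exists_mem_children_of_not_isCenterStarAt h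
  have hexc := edgeWeight_three_three_add_two_le_excess (notMem_core_of_mem_children hw) hne
    (by rw [map_of_mem_children hw]; omega)
  have hsum := excess_le_sum_children hw
  have hdeg := edgeWeight_mono (a := 3) (b := 4) (b' := deg φ v) (by norm_num) le_rfl (by norm_num)
    (by exact_mod_cast hd)
  have hbound : BranchShape.zTree.charge 6 + 1 < 2 * edgeWeight 3 4 + 2 := by
    norm_num [BranchShape.charge, edgeWeight, tail]
  unfold charge
  linarith

lemma isZTreeAt_or_lt_charge_of_deg_eq_three (hv : v ∈ core φ) (hd : deg φ v = 3)
    (hcenter : ¬ IsCenterStarAt φ v) (hleaf : ¬ IsLeafStarAt φ v) :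
    IsZTreeAt φ v ∨ BranchShape.zTree.charge (branch φ v).card < charge φ v := by
  obtain ⟨w, hw, hne⟩ := exists_mem_children_of_not_isCenterStarAt hcenter
  obtain ⟨w', hvw⟩ : ∃ w', children φ v = {w'} := by
    rw [← card_eq_one]
    rw [deg_of_mem_core hv] at hd
    omega
  obtain rfl : w = w' := by simpa only [hvw, mem_singleton] using hw
  have hstar : ¬ IsCenterStarAt φ w := fun h => hleaf ⟨w, hvw, hne, h⟩
  by_contra! hlt
  refine hlt.1 ⟨w, hvw, isLeafStarAt_of_excess_le (notMem_core_of_mem_children hw)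
    (by rw [map_of_mem_children hw, hd]) hstar ?_⟩
  have hcard : ((branch φ v).card : ℝ) - 3 = (branch φ w).card - 2 := by
    rw [card_branch_of_children_eq_singleton hvw]
    push_cast
    ring
  have := hlt.2
  rw [charge_of_children_eq_singleton hv hvw, BranchShape.charge, hcard] at this
  linarith

lemma three_le_deg_of_not_isCenterStarAt (hv : v ∈ core φ) (h : ¬ IsCenterStarAt φ v) :
    3 ≤ deg φ v := by
  obtain ⟨w, hw, -⟩ := exists_mem_children_of_not_isCenterStarAt h
  exact three_le_deg hv ⟨w, hw⟩

lemma isZTreeAt_or_lt_charge (hv : v ∈ core φ) (hs : 6 ≤ (branch φ v).card)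
    (hcenter : ¬ IsCenterStarAt φ v) :
    IsZTreeAt φ v ∨ BranchShape.zTree.charge (branch φ v).card < charge φ v := by
  obtain hd | hd := (three_le_deg_of_not_isCenterStarAt hv hcenter).eq_or_lt
  · by_cases hleaf : IsLeafStarAt φ v
    · rw [hleaf.charge_eq hv]
      exact Or.inr (BranchShape.charge_zTree_lt_charge_leafStar hs)
    · exact isZTreeAt_or_lt_charge_of_deg_eq_three hv hd.symm hcenter hleaf
  · exact Or.inr ((BranchShape.charge_zTree_anti (by norm_num) hs).trans_lt
      (lt_charge_of_four_le_deg hd hcenter))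

lemma isZTreeAt_or_lt_charge_of_seven_le (hv : v ∈ core φ) (hs : 7 ≤ (branch φ v).card) :
    IsZTreeAt φ v ∨ BranchShape.zTree.charge (branch φ v).card < charge φ v := by
  by_cases hcenter : IsCenterStarAt φ v
  · rw [hcenter.charge_eq hv]
    exact Or.inr (BranchShape.charge_zTree_lt_charge_centerStar hs)
  · exact isZTreeAt_or_lt_charge hv (by omega) hcenter

lemma isLeafStarAt_or_lt_charge (hv : v ∈ core φ)
    (hs : (branch φ v).card = 4 ∨ (branch φ v).card = 5) (hcenter : ¬ IsCenterStarAt φ v) :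
    IsLeafStarAt φ v ∨ BranchShape.leafStar.charge (branch φ v).card < charge φ v := by
  rw [or_iff_not_imp_left]
  intro hleaf
  obtain hd | hd := (three_le_deg_of_not_isCenterStarAt hv hcenter).eq_or_lt
  · refine (BranchShape.charge_leafStar_lt_charge_zTree hs).trans_le ?_
    obtain hz | hlt := isZTreeAt_or_lt_charge_of_deg_eq_three hv hd.symm hcenter hleaf
    exacts [(hz.charge_eq hv).ge, hlt.le]
  · refine lt_trans ?_ (lt_charge_of_four_le_deg hd hcenter)
    rcases hs with hs | hs <;> rw [hs] <;> norm_num [BranchShape.charge, edgeWeight, tail]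

end FunctionalGraph

namespace IsOrientation

open FunctionalGraph

variable {V : Type*} [Fintype V] {G : SimpleGraph V} {φ : V → V} {v : V}

lemma augmentedZagrebIndex_eq_add_sum_core (h : IsOrientation G φ) :
    augmentedZagrebIndex G = Fintype.card V + ∑ v ∈ core φ, charge φ v +
      ∑ v ∈ core φ, interaction (deg φ v) (deg φ (φ v)) := by
  have hexcess : augmentedZagrebIndex G = Fintype.card V + ∑ v ∈ core φ, excess φ v := by
    rw [h.augmentedZagrebIndex_eq, ← sum_card_branch φ, Nat.cast_sum, ← sum_add_distrib,
      sum_univ φ]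
    refine sum_congr rfl fun v _ => ?_
    rw [excess, sum_sub_distrib, sum_const, nsmul_one, add_sub_cancel]
  rw [hexcess, add_assoc, add_right_inj, ← sub_eq_zero, ← sum_add_distrib, ← sum_sub_distrib]
  calc ∑ v ∈ core φ, (excess φ v - (charge φ v + interaction (deg φ v) (deg φ (φ v))))
    _ = ∑ v ∈ core φ, (edgeWeight 3 (deg φ (φ v)) - edgeWeight 3 (deg φ v)) :=
      sum_congr rfl fun v _ => by
        rw [excess_eq, charge, interaction]
        ring
    _ = 0 := by rw [sum_sub_distrib, sum_core_comp φ fun v => edgeWeight 3 (deg φ v), sub_self]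

end IsOrientation

/-- The cycle of the functional graph of `φ` has exactly the three distinct vertices `t i`. -/
structure IsTriangle {V : Type*} [Fintype V] (φ : V → V) (t : Fin 3 → V) : Prop where
  injective : Injective t
  mem_core_iff : ∀ v, v ∈ FunctionalGraph.core φ ↔ ∃ i, t i = v

namespace IsTriangle

open FunctionalGraph

variable {V : Type*} [Fintype V] {G : SimpleGraph V} {φ : V → V} {t : Fin 3 → V} {v : V}

lemma mem_core (ht : IsTriangle φ t) (i : Fin 3) : t i ∈ core φ := (ht.mem_core_iff _).2 ⟨i, rfl⟩

lemma comp_equiv (ht : IsTriangle φ t) (e : Fin 3 ≃ Fin 3) : IsTriangle φ (t ∘ e) where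
  injective := ht.injective.comp e.injective
  mem_core_iff v := (ht.mem_core_iff v).trans e.surjective.exists

lemma sum_core {M : Type*} [AddCommMonoid M] (ht : IsTriangle φ t) (F : V → M) :
    ∑ v ∈ core φ, F v = F (t 0) + F (t 1) + F (t 2) := by
  have hcore : core φ = univ.map ⟨t, ht.injective⟩ := by
    ext v
    simp [ht.mem_core_iff]
  rw [hcore, sum_map, Fin.sum_univ_three]
  rfl

lemma map_eq_or_map_eq (ht : IsTriangle φ t) (h : IsOrientation G φ) {i j : Fin 3} (hij : i ≠ j) :
    φ (t i) = t j ∨ φ (t j) = t i := by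
  have hmap (a : Fin 3) : ∃ b, t b = φ (t a) := (ht.mem_core_iff _).1 (map_mem_core (ht.mem_core a))
  choose f hf using hmap
  have hf1 (a : Fin 3) : f a ≠ a := fun ha => h.map_ne (t a) (by rw [← hf, ha])
  have hf2 (a : Fin 3) : f (f a) ≠ a := fun ha => h.map_map_ne (t a) (by rw [← hf, ← hf, ha])
  have hperm : f i = j ∨ f j = i := by
    rw [or_iff_not_imp_left]
    intro hfi
    have := hf1 i; have := hf1 (f i); have := hf2 i
    have hffi : f (f i) = j := by omega
    have := hf1 j; have := hffi ▸ hf2 (f i)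
    omega
  rw [← hf, ← hf, ht.injective.eq_iff, ht.injective.eq_iff]
  exact hperm

lemma exists_of_card_core_eq_three (h3 : (core φ).card = 3) (hv : v ∈ core φ) :
    ∃ t, IsTriangle φ t ∧ t 0 = v ∧ (branch φ (t 1)).card ≤ (branch φ (t 2)).card := by
  let e := ((core φ).equivFinOfCardEq h3).symm
  have ht : IsTriangle φ fun i => e i :=
    ⟨Subtype.val_injective.comp e.injective, fun w =>
      ⟨fun hw => ⟨e.symm ⟨w, hw⟩, by simp⟩, fun ⟨i, hi⟩ => hi ▸ (e i).2⟩⟩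
  have ht₀ := ht.comp_equiv (Equiv.swap 0 (e.symm ⟨v, hv⟩))
  set t₀ := (fun i => (e i : V)) ∘ Equiv.swap 0 (e.symm ⟨v, hv⟩)
  have hv₀ : t₀ 0 = v := by simp [t₀]
  obtain hle | hle := le_total (branch φ (t₀ 1)).card (branch φ (t₀ 2)).card
  · exact ⟨t₀, ht₀, hv₀, hle⟩
  · exact ⟨_, ht₀.comp_equiv (Equiv.swap 1 2), hv₀, hle⟩

end IsTriangle

namespace IsOrientation

open FunctionalGraph

variable {V : Type*} [Fintype V] {G : SimpleGraph V} {φ : V → V} {t : Fin 3 → V} {v : V}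

lemma augmentedZagrebIndex_eq_add_sum_charge (h : IsOrientation G φ)
    (hdeg : ∀ v ∈ core φ, deg φ v = 3 ∨ deg φ (φ v) = 3) :
    augmentedZagrebIndex G = Fintype.card V + ∑ v ∈ core φ, charge φ v := by
  rw [h.augmentedZagrebIndex_eq_add_sum_core, add_eq_left]
  refine sum_eq_zero fun v hv => ?_
  rcases hdeg v hv with h3 | h3 <;> rw [h3]
  · exact interaction_three_left _
  · rw [interaction_comm]
    exact interaction_three_left _

lemma interaction_deg_nonneg (hdeg : ∀ v ∈ core φ, 3 ≤ deg φ v) (hv : v ∈ core φ) :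
    0 ≤ interaction (deg φ v) (deg φ (φ v)) :=
  interaction_nonneg (by exact_mod_cast hdeg v hv) (by exact_mod_cast hdeg _ (map_mem_core hv))

lemma card_add_sum_charge_le (h : IsOrientation G φ) (hdeg : ∀ v ∈ core φ, 3 ≤ deg φ v) :
    Fintype.card V + ∑ v ∈ core φ, charge φ v ≤ augmentedZagrebIndex G := by
  rw [h.augmentedZagrebIndex_eq_add_sum_core, le_add_iff_nonneg_right]
  exact sum_nonneg fun v hv => interaction_deg_nonneg hdeg hv

lemma card_add_sum_charge_add_interaction_le (h : IsOrientation G φ) (ht : IsTriangle φ t)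
    (hdeg : ∀ v ∈ core φ, 3 ≤ deg φ v) {i j : Fin 3} (hij : i ≠ j) :
    Fintype.card V + ∑ v ∈ core φ, charge φ v + interaction (deg φ (t i)) (deg φ (t j)) ≤
      augmentedZagrebIndex G := by
  rw [h.augmentedZagrebIndex_eq_add_sum_core, add_le_add_iff_left]
  have hle (i : Fin 3) := single_le_sum (f := fun v => interaction (deg φ v) (deg φ (φ v)))
    (fun v hv => interaction_deg_nonneg hdeg hv) (ht.mem_core i)
  rcases ht.map_eq_or_map_eq h hij with hφ | hφ
  · exact hφ ▸ hle i
  · rw [interaction_comm]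
    exact hφ ▸ hle j

end IsOrientation

namespace FunctionalGraph

variable {V : Type*} [Fintype V] {G : SimpleGraph V} {φ : V → V} {t : Fin 3 → V} {v w : V} {k : ℕ}

/-- The cycle is a triangle, and the trees hanging at its vertices have the shapes `S i` and the
numbers of vertices `s i`. -/
def HasBranches (φ : V → V) (S : Fin 3 → BranchShape) (s : Fin 3 → ℕ) : Prop :=
  ∃ t, IsTriangle φ t ∧ ∀ i, HasShape φ (t i) (S i) ∧ (branch φ (t i)).card = s i

lemma three_le_deg_of_four_le_card_branch (hv : v ∈ core φ) (h : 4 ≤ (branch φ v).card) :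
    3 ≤ deg φ v :=
  three_le_deg hv (nonempty_children_iff.2 (by omega))

lemma zTree_charge_le (hv : v ∈ core φ) (hs : 6 ≤ (branch φ v).card)
    (hcenter : ¬ IsCenterStarAt φ v) :
    BranchShape.zTree.charge (branch φ v).card ≤ charge φ v := by
  obtain hz | hlt := isZTreeAt_or_lt_charge hv hs hcenter
  exacts [(hz.charge_eq hv).ge, hlt.le]

lemma isLeafStarAt_and_card_eq_or_lt_charge (hk : k = 4 ∨ k = 5) (hv : v ∈ core φ)
    (hs : k ≤ (branch φ v).card) (hcenter : ¬ IsCenterStarAt φ v) :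
    (IsLeafStarAt φ v ∧ (branch φ v).card = k) ∨ BranchShape.leafStar.charge k < charge φ v := by
  have hmono : BranchShape.leafStar.charge 4 < BranchShape.leafStar.charge 5 ∧
      BranchShape.leafStar.charge 5 < 27.39 := by
    norm_num [BranchShape.charge, edgeWeight, tail]
  obtain hs6 | hs6 := le_or_gt 6 (branch φ v).card
  · have := zTree_charge_le hv hs6 hcenter
    have := BranchShape.lt_charge_zTree (s := (branch φ v).card) (by omega)
    rcases hk with rfl | rfl <;> exact Or.inr (by linarith)
  obtain hleaf | hlt := isLeafStarAt_or_lt_charge hv (by omega) hcenter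
  · obtain heq | hne := eq_or_ne (branch φ v).card k
    · exact Or.inl ⟨hleaf, heq⟩
    · obtain ⟨rfl, h5⟩ : k = 4 ∧ (branch φ v).card = 5 := by omega
      rw [hleaf.charge_eq hv, h5]
      exact Or.inr hmono.1
  · obtain heq | hne := eq_or_ne (branch φ v).card k
    · exact Or.inr (heq ▸ hlt)
    · obtain ⟨rfl, h5⟩ : k = 4 ∧ (branch φ v).card = 5 := by omega
      exact Or.inr (hmono.1.trans (h5 ▸ hlt))

lemma leafStar_charge_le (hk : k = 4 ∨ k = 5) (hv : v ∈ core φ)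
    (hs : k ≤ (branch φ v).card) (hcenter : ¬ IsCenterStarAt φ v) :
    BranchShape.leafStar.charge k ≤ charge φ v := by
  obtain ⟨hleaf, rfl⟩ | hlt := isLeafStarAt_and_card_eq_or_lt_charge hk hv hs hcenter
  exacts [(hleaf.charge_eq hv).ge, hlt.le]

lemma centerStar_charge_le (hk4 : 4 ≤ k) (hk6 : k ≤ 6) (hv : v ∈ core φ)
    (hs : k ≤ (branch φ v).card) : BranchShape.centerStar.charge k ≤ charge φ v := by
  by_cases hcenter : IsCenterStarAt φ v
  · rw [hcenter.charge_eq hv]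
    exact BranchShape.charge_centerStar_mono (by omega) hs
  obtain hk | rfl : (k = 4 ∨ k = 5) ∨ k = 6 := by omega
  · refine le_trans ?_ (leafStar_charge_le hk hv hs hcenter)
    rcases hk with rfl | rfl <;> norm_num [BranchShape.charge, edgeWeight, tail]
  · have : BranchShape.centerStar.charge 6 < 27.39 := by norm_num [BranchShape.charge, edgeWeight]
    have := BranchShape.lt_charge_zTree (s := (branch φ v).card) (by omega)
    have := zTree_charge_le hv hs hcenter
    linarith

lemma isZTreeAt_and_card_eq_of_charge_add_charge_le
    (hv : IsZTreeAt φ v ∨ BranchShape.zTree.charge (branch φ v).card < charge φ v)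
    (hw : IsZTreeAt φ w ∨ BranchShape.zTree.charge (branch φ w).card < charge φ w)
    (hvc : v ∈ core φ) (hwc : w ∈ core φ) (hs : 4 ≤ (branch φ v).card)
    (hle : (branch φ v).card ≤ (branch φ w).card) {p q : ℕ} (hpq : p ≤ q) (hqp : q ≤ p + 1)
    (hsum : (branch φ v).card + (branch φ w).card = p + q)
    (h : charge φ v + charge φ w ≤ BranchShape.zTree.charge p + BranchShape.zTree.charge q) :
    (IsZTreeAt φ v ∧ (branch φ v).card = p) ∧ IsZTreeAt φ w ∧ (branch φ w).card = q := by
  have hv' : BranchShape.zTree.charge (branch φ v).card ≤ charge φ v :=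
    hv.elim (fun hz => (hz.charge_eq hvc).ge) le_of_lt
  have hw' : BranchShape.zTree.charge (branch φ w).card ≤ charge φ w :=
    hw.elim (fun hz => (hz.charge_eq hwc).ge) le_of_lt
  have hcard : (branch φ v).card = p := by
    by_contra hne
    have := BranchShape.charge_zTree_balanced_lt (s := (branch φ v).card)
      (t := (branch φ w).card) hs (by omega)
    rw [hsum, show (p + q) / 2 = p by omega, show (p + q + 1) / 2 = q by omega] at this
    linarith
  have hcard' : (branch φ w).card = q := by omega
  rw [hcard] at hv hv'
  rw [hcard'] at hw hw'
  exact ⟨⟨hv.resolve_right fun hlt => by linarith, hcard⟩,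
    hw.resolve_right fun hlt => by linarith, hcard'⟩

end FunctionalGraph

namespace IsTriangle

open FunctionalGraph

variable {V : Type*} [Fintype V] {φ : V → V} {t : Fin 3 → V}

lemma hasBranches (ht : IsTriangle φ t) {σ₀ σ₁ σ₂ : BranchShape} {s₀ s₁ s₂ : ℕ}
    (h₀ : HasShape φ (t 0) σ₀) (hs₀ : (branch φ (t 0)).card = s₀)
    (h₁ : HasShape φ (t 1) σ₁) (hs₁ : (branch φ (t 1)).card = s₁)
    (h₂ : HasShape φ (t 2) σ₂) (hs₂ : (branch φ (t 2)).card = s₂) :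
    HasBranches φ ![σ₀, σ₁, σ₂] ![s₀, s₁, s₂] :=
  ⟨t, ht, fun i => match i with
    | 0 => ⟨h₀, hs₀⟩
    | 1 => ⟨h₁, hs₁⟩
    | 2 => ⟨h₂, hs₂⟩⟩

lemma sum_card_branch (ht : IsTriangle φ t) :
    (branch φ (t 0)).card + (branch φ (t 1)).card + (branch φ (t 2)).card = Fintype.card V := by
  rw [← FunctionalGraph.sum_card_branch φ, ht.sum_core]

end IsTriangle

namespace IsOrientation

open FunctionalGraph

variable {V : Type*} [Fintype V] {G : SimpleGraph V} {φ : V → V} {t : Fin 3 → V} {x : V} {k : ℕ}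

lemma card_core_eq_three (h : IsOrientation G φ) (hsize : ∀ v ∈ core φ, 4 ≤ (branch φ v).card)
    (hAZI : augmentedZagrebIndex G ≤ Fintype.card V + 86) : (core φ).card = 3 := by
  refine le_antisymm ?_ h.three_le_card_core
  by_contra! hcard
  have hcard' : (4 : ℝ) ≤ (core φ).card := by exact_mod_cast hcard
  have hsum := card_nsmul_le_sum (core φ) (charge φ) (BranchShape.centerStar.charge 4) fun v hv =>
    centerStar_charge_le le_rfl (by norm_num) hv (hsize v hv)
  have h4 : 21.7 ≤ BranchShape.centerStar.charge 4 := by norm_num [BranchShape.charge, edgeWeight]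
  have := h.card_add_sum_charge_le fun v hv => three_le_deg_of_four_le_card_branch hv (hsize v hv)
  rw [nsmul_eq_mul] at hsum
  nlinarith

lemma sum_charge_le (h : IsOrientation G φ) (ht : IsTriangle φ t)
    (hsize : ∀ v ∈ core φ, 4 ≤ (branch φ v).card) {M : ℝ}
    (hAZI : augmentedZagrebIndex G ≤ Fintype.card V + M) :
    charge φ (t 0) + charge φ (t 1) + charge φ (t 2) ≤ M := by
  have := h.card_add_sum_charge_le fun v hv => three_le_deg_of_four_le_card_branch hv (hsize v hv)
  rw [ht.sum_core] at this
  linarith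

lemma hasBranches_graphA (h : IsOrientation G φ) (hk : 7 ≤ k) (hn : 3 * k + 3 ≤ Fintype.card V)
    (hsize : ∀ v ∈ core φ, k ≤ (branch φ v).card) (hx : x ∈ core φ) (hxk : (branch φ x).card = k)
    (hAZI : augmentedZagrebIndex G ≤ Fintype.card V + (BranchShape.zTree.charge k +
      BranchShape.zTree.charge ((Fintype.card V - k) / 2) +
      BranchShape.zTree.charge ((Fintype.card V - k + 1) / 2))) :
    HasBranches φ ![.zTree, .zTree, .zTree]
      ![k, (Fintype.card V - k) / 2, (Fintype.card V - k + 1) / 2] := by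
  have hsize4 : ∀ v ∈ core φ, 4 ≤ (branch φ v).card := fun v hv => by have := hsize v hv; omega
  have hz (v) (hv : v ∈ core φ) := isZTreeAt_or_lt_charge_of_seven_le hv (hk.trans (hsize v hv))
  have h7 : BranchShape.zTree.charge 7 < 28.21 := by norm_num [BranchShape.charge, edgeWeight, tail]
  have h7le {s : ℕ} (hs : 7 ≤ s) := BranchShape.charge_zTree_anti (by norm_num) hs
  have h3 : (core φ).card = 3 := h.card_core_eq_three hsize4 (by
    have := h7le hk
    have := h7le (s := (Fintype.card V - k) / 2) (by omega)
    have := h7le (s := (Fintype.card V - k + 1) / 2) (by omega)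
    linarith)
  obtain ⟨t, ht, rfl, hle⟩ := IsTriangle.exists_of_card_core_eq_three h3 hx
  have hcharge := h.sum_charge_le ht hsize4 hAZI
  have hcard := ht.sum_card_branch
  have hz₀ := hz _ (ht.mem_core 0)
  have hle₀ : BranchShape.zTree.charge k ≤ charge φ (t 0) :=
    hxk ▸ hz₀.elim (fun h => (h.charge_eq hx).ge) le_of_lt
  obtain ⟨⟨h₁, hs₁⟩, h₂, hs₂⟩ := isZTreeAt_and_card_eq_of_charge_add_charge_le
    (hz _ (ht.mem_core 1)) (hz _ (ht.mem_core 2)) (ht.mem_core 1) (ht.mem_core 2)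
    (hsize4 _ (ht.mem_core 1)) hle (p := (Fintype.card V - k) / 2)
    (q := (Fintype.card V - k + 1) / 2) (by omega) (by omega) (by omega) (by linarith)
  have h₀ : IsZTreeAt φ (t 0) := hz₀.resolve_right fun hlt => by
    have := h₁.charge_eq (ht.mem_core 1)
    have := h₂.charge_eq (ht.mem_core 2)
    rw [hs₁, hs₂, hxk] at *
    linarith
  exact ht.hasBranches h₀ hxk h₁ hs₁ h₂ hs₂

lemma three_mul_charge_add_interaction_le (h : IsOrientation G φ) (ht : IsTriangle φ t)
    (hk4 : 4 ≤ k) (hk6 : k ≤ 6) (hsize : ∀ v ∈ core φ, k ≤ (branch φ v).card) {i j : Fin 3}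
    (hij : i ≠ j) (hi : IsCenterStarAt φ (t i)) (hj : IsCenterStarAt φ (t j)) :
    Fintype.card V + (3 * BranchShape.centerStar.charge k + interaction 5 5) ≤
      augmentedZagrebIndex G := by
  have hcharge (i : Fin 3) :=
    centerStar_charge_le hk4 hk6 (ht.mem_core i) (hsize _ (ht.mem_core i))
  have hdeg {i : Fin 3} (hi : IsCenterStarAt φ (t i)) : (5 : ℝ) ≤ deg φ (t i) := by
    have := hsize _ (ht.mem_core i)
    rw [hi.deg_eq (ht.mem_core i)]
    exact_mod_cast (by omega)
  have := h.card_add_sum_charge_add_interaction_le ht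
    (fun v hv => three_le_deg_of_four_le_card_branch hv (hk4.trans (hsize v hv))) hij
  have := interaction_mono (by norm_num) (hdeg hi) (by norm_num) (hdeg hj)
  have := hcharge 0
  have := hcharge 1
  have := hcharge 2
  rw [ht.sum_core] at *
  linarith

/-- `L` stands for a lower bound on the charge of a vertex whose hanging tree is not a star with
center on the cycle, `L₀` for one at the vertex `x`, and `M` for the optimum. -/
lemma exists_isCenterStarAt (h : IsOrientation G φ) (h3 : (core φ).card = 3)
    (hsize : ∀ v ∈ core φ, 4 ≤ (branch φ v).card) {L L₀ M : ℝ}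
    (hL : ∀ v ∈ core φ, ¬ IsCenterStarAt φ v → L ≤ charge φ v) (hx : x ∈ core φ)
    (hL₀ : ¬ IsCenterStarAt φ x → L₀ ≤ charge φ x) (hM : M < L₀ + 2 * L)
    (hAZI : augmentedZagrebIndex G ≤ Fintype.card V + M) : ∃ v ∈ core φ, IsCenterStarAt φ v := by
  by_contra! hno
  obtain ⟨t, ht, rfl, -⟩ := IsTriangle.exists_of_card_core_eq_three h3 hx
  have := h.sum_charge_le ht hsize hAZI
  have := hL₀ (hno _ hx)
  have := hL _ (ht.mem_core 1) (hno _ (ht.mem_core 1))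
  have := hL _ (ht.mem_core 2) (hno _ (ht.mem_core 2))
  linarith

lemma exists_isTriangle_isCenterStarAt (h : IsOrientation G φ) (h3 : (core φ).card = 3)
    (hk4 : 4 ≤ k) (hk6 : k ≤ 6) (hsize : ∀ v ∈ core φ, k ≤ (branch φ v).card) {L M : ℝ}
    (hL : ∀ v ∈ core φ, ¬ IsCenterStarAt φ v → L ≤ charge φ v)
    (hML : M < BranchShape.centerStar.charge (k + 1) + 2 * L)
    (hM : M < 3 * BranchShape.centerStar.charge k + interaction 5 5)
    (hAZI : augmentedZagrebIndex G ≤ Fintype.card V + M)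
    (hcenter : ∃ v ∈ core φ, IsCenterStarAt φ v) :
    ∃ t, IsTriangle φ t ∧ IsCenterStarAt φ (t 0) ∧ (branch φ (t 0)).card = k ∧
      (∀ i ≠ 0, ¬ IsCenterStarAt φ (t i)) ∧ (branch φ (t 1)).card ≤ (branch φ (t 2)).card := by
  obtain ⟨v, hv, hc⟩ := hcenter
  obtain ⟨t, ht, rfl, hle⟩ := IsTriangle.exists_of_card_core_eq_three h3 hv
  have huniq : ∀ i ≠ 0, ¬ IsCenterStarAt φ (t i) := fun i hi hic => by
    have := h.three_mul_charge_add_interaction_le ht hk4 hk6 hsize hi hic hc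
    linarith
  refine ⟨t, ht, hc, ?_, huniq, hle⟩
  by_contra hne
  have hmono := BranchShape.charge_centerStar_mono (s := k + 1) (t := (branch φ (t 0)).card)
    (by omega) (by have := hsize _ hv; omega)
  rw [← hc.charge_eq hv] at hmono
  have := h.sum_charge_le ht (fun v hv => hk4.trans (hsize v hv)) hAZI
  have := hL _ (ht.mem_core 1) (huniq 1 (by decide))
  have := hL _ (ht.mem_core 2) (huniq 2 (by decide))
  linarith

lemma hasBranches_graphB (h : IsOrientation G φ) (hn : 21 ≤ Fintype.card V)
    (hsize : ∀ v ∈ core φ, 6 ≤ (branch φ v).card) (hx : x ∈ core φ) (hx6 : (branch φ x).card = 6)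
    (hAZI : augmentedZagrebIndex G ≤ Fintype.card V + (BranchShape.centerStar.charge 6 +
      BranchShape.zTree.charge (Fintype.card V / 2 - 3) +
      BranchShape.zTree.charge ((Fintype.card V + 1) / 2 - 3))) :
    HasBranches φ ![.centerStar, .zTree, .zTree]
      ![6, Fintype.card V / 2 - 3, (Fintype.card V + 1) / 2 - 3] := by
  have hsize4 : ∀ v ∈ core φ, 4 ≤ (branch φ v).card := fun v hv => by have := hsize v hv; omega
  set p := Fintype.card V / 2 - 3
  set q := (Fintype.card V + 1) / 2 - 3
  have hM : BranchShape.centerStar.charge 6 + BranchShape.zTree.charge p +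
      BranchShape.zTree.charge q < 82.98 := by
    have := BranchShape.charge_zTree_anti (s := 7) (t := p) (by norm_num) (by omega)
    have := BranchShape.charge_zTree_anti (s := 8) (t := q) (by norm_num) (by omega)
    have : BranchShape.centerStar.charge 6 + BranchShape.zTree.charge 7 +
      BranchShape.zTree.charge 8 < 82.98 := by norm_num [BranchShape.charge, edgeWeight, tail]
    linarith
  have hL : ∀ v ∈ core φ, ¬ IsCenterStarAt φ v → 27.39 ≤ charge φ v := fun v hv hc =>
    (BranchShape.lt_charge_zTree (hsize4 v hv)).le.trans (zTree_charge_le hv (hsize v hv) hc)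
  have h3 := h.card_core_eq_three hsize4 (by linarith)
  have hcenter := h.exists_isCenterStarAt h3 hsize4 hL hx
    (fun hc => hx6 ▸ zTree_charge_le hx (hsize x hx) hc)
    (hM.trans (by norm_num [BranchShape.charge, edgeWeight, tail])) hAZI
  obtain ⟨t, ht, h₀, hs₀, huniq, hle⟩ := h.exists_isTriangle_isCenterStarAt h3 (by norm_num) le_rfl
    hsize hL (hM.trans (by norm_num [BranchShape.charge, edgeWeight]))
    (hM.trans (by norm_num [BranchShape.charge, edgeWeight, interaction])) hAZI hcenter
  have hcharge := h.sum_charge_le ht hsize4 hAZI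
  have hcard := ht.sum_card_branch
  have hz (i) (hi : i ≠ 0) :=
    isZTreeAt_or_lt_charge (ht.mem_core i) (hsize _ (ht.mem_core i)) (huniq i hi)
  rw [h₀.charge_eq (ht.mem_core 0), hs₀] at hcharge
  obtain ⟨⟨h₁, hs₁⟩, h₂, hs₂⟩ := isZTreeAt_and_card_eq_of_charge_add_charge_le
    (hz 1 (by decide)) (hz 2 (by decide)) (ht.mem_core 1) (ht.mem_core 2)
    (hsize4 _ (ht.mem_core 1)) hle (p := p) (q := q) (by omega) (by omega) (by omega) (by linarith)
  exact ht.hasBranches h₀ hs₀ h₁ hs₁ h₂ hs₂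

lemma hasBranches_graphC (h : IsOrientation G φ) (hk : k = 4 ∨ k = 5)
    (hn : 3 * k + 3 ≤ Fintype.card V) (hsize : ∀ v ∈ core φ, k ≤ (branch φ v).card)
    (hAZI : augmentedZagrebIndex G ≤ Fintype.card V + (BranchShape.centerStar.charge k +
      BranchShape.leafStar.charge k + BranchShape.zTree.charge (Fintype.card V - 2 * k))) :
    HasBranches φ ![.centerStar, .leafStar, .zTree] ![k, k, Fintype.card V - 2 * k] := by
  have hsize4 : ∀ v ∈ core φ, 4 ≤ (branch φ v).card := fun v hv => by have := hsize v hv; omega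
  have hz7 := BranchShape.charge_zTree_anti (s := 7) (t := Fintype.card V - 2 * k) (by norm_num)
    (by omega)
  have hL : ∀ v ∈ core φ, ¬ IsCenterStarAt φ v → BranchShape.leafStar.charge k ≤ charge φ v :=
    fun v hv => leafStar_charge_le hk hv (hsize v hv)
  have h3 := h.card_core_eq_three hsize4 (hAZI.trans (add_le_add_right (by
    refine (add_le_add_right hz7 _).trans ?_
    rcases hk with rfl | rfl <;> norm_num [BranchShape.charge, edgeWeight, tail]) _))
  obtain ⟨x, hx⟩ := h.core_nonempty
  have hcenter := h.exists_isCenterStarAt h3 hsize4 hL hx (hL x hx)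
    ((add_le_add_right hz7 _).trans_lt (by
      rcases hk with rfl | rfl <;> norm_num [BranchShape.charge, edgeWeight, tail])) hAZI
  obtain ⟨t, ht, h₀, hs₀, huniq, hle⟩ := h.exists_isTriangle_isCenterStarAt h3 (by omega)
    (by omega) hsize hL
    ((add_le_add_right hz7 _).trans_lt (by
      rcases hk with rfl | rfl <;> norm_num [BranchShape.charge, edgeWeight, tail]))
    ((add_le_add_right hz7 _).trans_lt (by
      rcases hk with rfl | rfl <;> norm_num [BranchShape.charge, edgeWeight, tail, interaction]))
    hAZI hcenter
  have hcharge := h.sum_charge_le ht hsize4 hAZI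
  have hcard := ht.sum_card_branch
  rw [h₀.charge_eq (ht.mem_core 0), hs₀] at hcharge
  have hk1 := hsize _ (ht.mem_core 1)
  have hz₂ := isZTreeAt_or_lt_charge (ht.mem_core 2) (by omega) (huniq 2 (by decide))
  have hle₂ := zTree_charge_le (ht.mem_core 2) (by omega) (huniq 2 (by decide))
  have hanti := BranchShape.charge_zTree_anti (hsize4 _ (ht.mem_core 2))
    (by omega : _ ≤ Fintype.card V - 2 * k)
  obtain ⟨h₁, hs₁⟩ := (isLeafStarAt_and_card_eq_or_lt_charge hk (ht.mem_core 1) hk1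
    (huniq 1 (by decide))).resolve_right fun hlt => by linarith
  have hs₂ : (branch φ (t 2)).card = Fintype.card V - 2 * k := by omega
  rw [h₁.charge_eq (ht.mem_core 1), hs₁] at hcharge
  rw [hs₂] at hz₂
  exact ht.hasBranches h₀ hs₀ h₁ hs₁ (hz₂.resolve_right fun hlt => by linarith) hs₂

end IsOrientation

namespace BranchShape

/-- The rooted tree that a shape stands for. -/
def tree : BranchShape → (q : ℕ) → SimpleGraph (Fin q)
  | centerStar => _root_.centerStar
  | leafStar => _root_.leafStar
  | zTree => _root_.zTree

/-- Each of the three rooted trees is a path `0, …, d` starting at the root `0`, with pendant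
vertices attached to its other end `d`; this is the label `d`, so that `min (a - 1) d` is the
parent of the vertex `a ≠ 0`. -/
def hub : BranchShape → ℕ
  | centerStar => 0
  | leafStar => 1
  | zTree => 2

lemma hub_le_two (σ : BranchShape) : σ.hub ≤ 2 := by cases σ <;> simp [hub]

lemma tree_adj (σ : BranchShape) {q : ℕ} (a b : Fin q) :
    (σ.tree q).Adj a b ↔ a ≠ b ∧ (min (a - 1 : ℕ) σ.hub = b ∨ min (b - 1 : ℕ) σ.hub = a) := by
  cases σ <;> simp only [tree, hub, _root_.centerStar, _root_.leafStar, _root_.zTree,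
    SimpleGraph.fromRel_adj, ne_eq, Fin.ext_iff] <;> omega

end BranchShape

lemma bijOn_cons {V : Type*} {f : ℕ → V} {m : ℕ} {s : Set V} {v : V} (hv : v ∉ s)
    (hf : Set.BijOn f (Set.Iio m) s) :
    Set.BijOn (fun a => Nat.casesOn a v f : ℕ → V) (Set.Iio (m + 1)) (insert v s) := by
  refine ⟨?_, ?_, ?_⟩
  · rintro (_ | a) ha
    · exact Set.mem_insert v s
    · exact Set.mem_insert_of_mem v (hf.mapsTo (Nat.lt_of_succ_lt_succ ha))
  · have hne {a : ℕ} (ha : a < m) : f a ≠ v := fun h => hv (h ▸ hf.mapsTo ha)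
    rintro (_ | a) ha (_ | b) hb hab
    · rfl
    · exact absurd hab.symm (hne (Nat.lt_of_succ_lt_succ hb))
    · exact absurd hab (hne (Nat.lt_of_succ_lt_succ ha))
    · rw [hf.injOn (Nat.lt_of_succ_lt_succ ha) (Nat.lt_of_succ_lt_succ hb) hab]
  · rintro w (rfl | hw)
    · exact ⟨0, Nat.succ_pos m, rfl⟩
    · obtain ⟨a, ha, rfl⟩ := hf.surjOn hw
      exact ⟨a + 1, Nat.succ_lt_succ ha, rfl⟩

namespace FunctionalGraph

variable {V : Type*} [Fintype V] {G : SimpleGraph V} {φ : V → V} {e : ℕ → V} {v w : V} {d : ℕ}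

/-- The values `e 0, e 1, …` enumerate the tree hanging at `v`, which is a path `e 0, …, e d`
starting at `v = e 0` with pendant vertices attached to `e d`. -/
structure IsBroomEnumeration (φ : V → V) (v : V) (d : ℕ) (e : ℕ → V) : Prop where
  bijOn : Set.BijOn e (Set.Iio (branch φ v).card) (branch φ v)
  apply_zero : e 0 = v
  map_apply : ∀ a < (branch φ v).card, a ≠ 0 → φ (e a) = e (min (a - 1) d)

lemma IsCenterStarAt.coe_branch (h : IsCenterStarAt φ v) :
    (branch φ v : Set V) = insert v (children φ v : Set V) := by
  ext u
  simp only [mem_coe, mem_branch_iff (v := v), Set.mem_insert_iff]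
  refine or_congr_right ⟨fun ⟨w, hw, hu⟩ => ?_, fun hu => ⟨u, hu, self_mem_branch u⟩⟩
  obtain rfl | ⟨c, hc, -⟩ := mem_branch_iff.1 hu
  · exact hw
  · simp [h w hw] at hc

lemma coe_branch_of_children_eq_singleton (h : children φ v = {w}) :
    (branch φ v : Set V) = insert v (branch φ w : Set V) := by
  ext u
  simp [mem_branch_iff (v := v), h]

lemma notMem_children_self (φ : V → V) (v : V) : v ∉ children φ v := fun h =>
  notMem_branch_of_mem_children h (self_mem_branch v)

lemma IsCenterStarAt.exists_isBroomEnumeration (h : IsCenterStarAt φ v) :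
    ∃ e, IsBroomEnumeration φ v 0 e := by
  have : Nonempty V := ⟨v⟩
  obtain ⟨f, hf⟩ := (Set.finite_Iio (children φ v).card).exists_bijOn_of_encard_eq
    (t := (children φ v : Set V)) (by
      rw [← coe_range, Set.encard_coe_eq_coe_finsetCard, Set.encard_coe_eq_coe_finsetCard,
        card_range])
  have hcard : (branch φ v).card = (children φ v).card + 1 := by rw [h.card_branch, add_comm]
  refine ⟨fun a => Nat.casesOn a v f, ?_, rfl, fun a ha ha0 => ?_⟩
  · rw [h.coe_branch, hcard]
    exact bijOn_cons (notMem_children_self φ v) hf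
  · obtain ⟨a, rfl⟩ := Nat.exists_eq_succ_of_ne_zero ha0
    rw [Nat.min_zero]
    exact map_of_mem_children (hf.mapsTo (by simpa [hcard] using ha))

lemma IsBroomEnumeration.exists_of_children_eq_singleton (he : IsBroomEnumeration φ w d e)
    (h : children φ v = {w}) : ∃ e', IsBroomEnumeration φ v (d + 1) e' := by
  have hw : w ∈ children φ v := h ▸ mem_singleton_self w
  have hcard := card_branch_of_children_eq_singleton h
  refine ⟨fun a => Nat.casesOn a v e, ?_, rfl, fun a ha ha0 => ?_⟩
  · rw [coe_branch_of_children_eq_singleton h, hcard]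
    exact bijOn_cons (notMem_branch_of_mem_children hw) he.bijOn
  · rcases a with _ | _ | a
    · exact absurd rfl ha0
    · exact (congrArg φ he.apply_zero).trans (map_of_mem_children hw)
    · rw [Nat.add_sub_cancel, Nat.add_min_add_right]
      exact he.map_apply (a + 1) (by omega) (Nat.succ_ne_zero a)

lemma HasShape.exists_isBroomEnumeration {σ : BranchShape} (h : HasShape φ v σ) :
    ∃ e, IsBroomEnumeration φ v σ.hub e :=
  match σ, h with
  | .centerStar, h => IsCenterStarAt.exists_isBroomEnumeration h
  | .leafStar, ⟨_, hvw, _, hw⟩ =>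
    hw.exists_isBroomEnumeration.elim fun _ he => he.exists_of_children_eq_singleton hvw
  | .zTree, ⟨_, hvw, _, hwc, _, hc⟩ =>
    hc.exists_isBroomEnumeration.elim fun _ he =>
      (he.exists_of_children_eq_singleton hwc).elim fun _ he' =>
        he'.exists_of_children_eq_singleton hvw

end FunctionalGraph

section TriangleWithTrees

variable {T : Fin 3 → (q : ℕ) → SimpleGraph (Fin q)} {s : Fin 3 → ℕ} {i j : Fin 3}

lemma triangleWithTrees_adj_mk_mk {a b : Fin (s i)} :
    (triangleWithTrees T s).Adj ⟨i, a⟩ ⟨i, b⟩ ↔ (T i (s i)).Adj a b := by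
  refine ⟨?_, fun h => Or.inl ⟨i, a, b, rfl, rfl, h⟩⟩
  rintro (⟨j, a', b', ha, hb, h⟩ | ⟨h, -⟩)
  · obtain ⟨rfl, ha⟩ := Sigma.mk.inj ha
    rw [eq_of_heq ha, eq_of_heq (Sigma.mk.inj hb).2]
    exact h
  · exact absurd rfl h

lemma triangleWithTrees_adj_of_ne (hij : i ≠ j) {a : Fin (s i)} {b : Fin (s j)} :
    (triangleWithTrees T s).Adj ⟨i, a⟩ ⟨j, b⟩ ↔ (a : ℕ) = 0 ∧ (b : ℕ) = 0 := by
  refine ⟨?_, fun h => Or.inr ⟨hij, h⟩⟩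
  rintro (⟨l, a', b', ha, hb, -⟩ | ⟨-, h⟩)
  · exact absurd ((congrArg Sigma.fst ha).trans (congrArg Sigma.fst hb).symm) hij
  · exact h

end TriangleWithTrees

namespace IsTriangle

open FunctionalGraph

variable {V : Type*} [Fintype V] {G : SimpleGraph V} {φ : V → V} {t : Fin 3 → V}
  {S : Fin 3 → BranchShape} {e : Fin 3 → ℕ → V} {i j : Fin 3} {a b : ℕ}

lemma mem_core_apply_iff (ht : IsTriangle φ t)
    (he : ∀ i, IsBroomEnumeration φ (t i) (S i).hub (e i)) (ha : a < (branch φ (t i)).card) :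
    e i a ∈ core φ ↔ a = 0 := by
  have hmem := (he i).bijOn.mapsTo ha
  refine ⟨fun hcore => ?_, fun h0 => by rw [h0, (he i).apply_zero]; exact ht.mem_core i⟩
  rw [mem_coe, mem_branch_iff_of_mem_core (ht.mem_core i) hcore, ← (he i).apply_zero] at hmem
  exact (he i).bijOn.injOn ha (card_branch_pos _) hmem

lemma bijective_sigma (ht : IsTriangle φ t)
    (he : ∀ i, IsBroomEnumeration φ (t i) (S i).hub (e i)) :
    Bijective fun x : Σ i, Fin (branch φ (t i)).card => e x.1 x.2 := by
  constructor
  · rintro ⟨i, a⟩ ⟨j, b⟩ hab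
    have ha := (he i).bijOn.mapsTo a.2
    have hb := (he j).bijOn.mapsTo b.2
    obtain rfl : i = j := by
      by_contra hij
      exact Finset.disjoint_left.1 (disjoint_branch_of_mem_core (ht.mem_core i) (ht.mem_core j)
        (ht.injective.ne hij)) ha (by simpa only [hab, mem_coe] using hb)
    rw [Fin.ext ((he i).bijOn.injOn a.2 b.2 hab)]
  · intro v
    obtain ⟨u, hu, hv⟩ := exists_mem_branch φ v
    obtain ⟨i, rfl⟩ := (ht.mem_core_iff u).1 hu
    obtain ⟨a, ha, rfl⟩ := (he i).bijOn.surjOn hv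
    exact ⟨⟨i, a, ha⟩, rfl⟩

lemma map_apply_eq_iff (ht : IsTriangle φ t)
    (he : ∀ i, IsBroomEnumeration φ (t i) (S i).hub (e i))
    (ha : a < (branch φ (t i)).card) (hb : b < (branch φ (t i)).card) (hab : a ≠ b) :
    φ (e i a) = e i b ↔ min (a - 1) (S i).hub = b := by
  obtain rfl | ha0 := eq_or_ne a 0
  · rw [(he i).apply_zero, Nat.zero_sub, Nat.zero_min]
    refine iff_of_false (fun hφ => hab ?_) hab
    exact ((ht.mem_core_apply_iff he hb).1 (hφ ▸ map_mem_core (ht.mem_core i))).symm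
  · rw [(he i).map_apply a ha ha0, (he i).bijOn.injOn.eq_iff _ hb]
    exact Set.mem_Iio.2 (by omega)

lemma eq_zero_of_map_apply_eq (ht : IsTriangle φ t)
    (he : ∀ i, IsBroomEnumeration φ (t i) (S i).hub (e i)) (hij : i ≠ j)
    (ha : a < (branch φ (t i)).card) (hb : b < (branch φ (t j)).card)
    (hab : φ (e i a) = e j b) : a = 0 ∧ b = 0 := by
  obtain rfl : a = 0 := by
    by_contra ha0
    have ha' := (he i).bijOn.mapsTo (show min (a - 1) (S i).hub ∈ Set.Iio _ from
      Set.mem_Iio.2 (by omega))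
    rw [← (he i).map_apply a ha ha0, hab] at ha'
    exact Finset.disjoint_left.1 (disjoint_branch_of_mem_core (ht.mem_core i) (ht.mem_core j)
      (ht.injective.ne hij)) ha' ((he j).bijOn.mapsTo hb)
  rw [(he i).apply_zero] at hab
  exact ⟨rfl, (ht.mem_core_apply_iff he hb).1 (hab ▸ map_mem_core (ht.mem_core i))⟩

lemma adj_apply_apply_iff (ht : IsTriangle φ t) (h : IsOrientation G φ)
    (he : ∀ i, IsBroomEnumeration φ (t i) (S i).hub (e i))
    (x y : Σ i, Fin (branch φ (t i)).card) :
    G.Adj (e x.1 x.2) (e y.1 y.2) ↔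
      (triangleWithTrees (fun i => (S i).tree) fun i => (branch φ (t i)).card).Adj x y := by
  obtain ⟨i, a⟩ := x
  obtain ⟨j, b⟩ := y
  rw [h.adj_iff]
  obtain rfl | hij := eq_or_ne i j
  · rw [triangleWithTrees_adj_mk_mk, BranchShape.tree_adj]
    obtain rfl | hab := eq_or_ne a b
    · simp [h.map_ne]
    · have hab' : (a : ℕ) ≠ b := Fin.val_injective.ne hab
      rw [ht.map_apply_eq_iff he a.2 b.2 hab', ht.map_apply_eq_iff he b.2 a.2 hab'.symm,
        and_iff_right hab]
  · rw [triangleWithTrees_adj_of_ne hij]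
    refine ⟨?_, fun ⟨ha, hb⟩ => ?_⟩
    · rintro (hφ | hφ)
      exacts [ht.eq_zero_of_map_apply_eq he hij a.2 b.2 hφ,
        (ht.eq_zero_of_map_apply_eq he hij.symm b.2 a.2 hφ).symm]
    · rw [ha, hb, (he i).apply_zero, (he j).apply_zero]
      exact ht.map_eq_or_map_eq h hij

end IsTriangle

lemma IsOrientation.nonempty_iso {V : Type*} [Fintype V] {G : SimpleGraph V} {φ : V → V}
    {S : Fin 3 → BranchShape} {s : Fin 3 → ℕ} (h : IsOrientation G φ)
    (hb : FunctionalGraph.HasBranches φ S s) :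
    Nonempty (G ≃g triangleWithTrees (fun i => (S i).tree) s) := by
  obtain ⟨t, ht, hS⟩ := hb
  obtain rfl : (fun i => (FunctionalGraph.branch φ (t i)).card) = s := funext fun i => (hS i).2
  choose e he using fun i => (hS i).1.exists_isBroomEnumeration
  exact ⟨RelIso.symm ⟨Equiv.ofBijective _ (ht.bijective_sigma he),
    fun {x y} => ht.adj_apply_apply_iff h he x y⟩⟩

lemma sigma_fin_eq_iff {ι : Type*} {s : ι → ℕ} {x y : Σ i, Fin (s i)} :
    x = y ↔ x.1 = y.1 ∧ (x.2 : ℕ) = y.2 := by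
  obtain ⟨i, a⟩ := x
  obtain ⟨j, b⟩ := y
  constructor
  · rintro ⟨⟩
    exact ⟨rfl, rfl⟩
  · intro ⟨hij, hab⟩
    cases (hij : i = j)
    exact congrArg _ (Fin.ext hab)

/-- The orientation of the graph `triangleWithTrees (fun i => (S i).tree) s`: the roots are permuted
cyclically, and every other vertex is mapped to its parent. -/
def triangleMap (S : Fin 3 → BranchShape) {s : Fin 3 → ℕ} (hs : ∀ i, 4 ≤ s i)
    (x : Σ i, Fin (s i)) : Σ i, Fin (s i) :=
  if (x.2 : ℕ) = 0 then ⟨x.1 + 1, 0, by have := hs (x.1 + 1); omega⟩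
  else ⟨x.1, min (x.2 - 1) (S x.1).hub, by omega⟩

section TriangleMap

variable {S : Fin 3 → BranchShape} {s : Fin 3 → ℕ} {hs : ∀ i, 4 ≤ s i} {x y : Σ i, Fin (s i)}

lemma triangleMap_eq_iff_of_eq_zero (hx : (x.2 : ℕ) = 0) :
    triangleMap S hs x = y ↔ x.1 + 1 = y.1 ∧ (y.2 : ℕ) = 0 := by
  rw [triangleMap, if_pos hx, sigma_fin_eq_iff, eq_comm (a := (y.2 : ℕ))]

lemma triangleMap_eq_iff_of_ne_zero (hx : (x.2 : ℕ) ≠ 0) :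
    triangleMap S hs x = y ↔ x.1 = y.1 ∧ min (x.2 - 1 : ℕ) (S x.1).hub = y.2 := by
  rw [triangleMap, if_neg hx, sigma_fin_eq_iff]

lemma triangleMap_snd_le (x : Σ i, Fin (s i)) : ((triangleMap S hs x).2 : ℕ) ≤ x.2 - 1 := by
  obtain hx | hx := eq_or_ne (x.2 : ℕ) 0
  · exact ((triangleMap_eq_iff_of_eq_zero hx).1 rfl).2.trans_le (Nat.zero_le _)
  · exact ((triangleMap_eq_iff_of_ne_zero hx).1 rfl).2.symm.trans_le (min_le_left _ _)

lemma triangleMap_iterate_snd_le (n : ℕ) : (((triangleMap S hs)^[n] x).2 : ℕ) ≤ x.2 - n := by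
  induction n with
  | zero => exact le_rfl
  | succ n ih =>
    rw [iterate_succ_apply']
    have := triangleMap_snd_le (S := S) (hs := hs) ((triangleMap S hs)^[n] x)
    omega

lemma triangleMap_iterate_eq_iff (hx : (x.2 : ℕ) = 0) (n : ℕ) :
    (triangleMap S hs)^[n] x = y ↔ x.1 + Fin.ofNat 3 n = y.1 ∧ (y.2 : ℕ) = 0 := by
  induction n generalizing x with
  | zero => rw [iterate_zero_apply, sigma_fin_eq_iff, hx, eq_comm (a := 0)]; simp
  | succ n ih =>
    have hmap := (triangleMap_eq_iff_of_eq_zero (S := S) (hs := hs) hx).1 rfl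
    rw [iterate_succ_apply, ih hmap.2, ← hmap.1]
    refine and_congr_left' (Eq.congr_left ?_)
    ext
    simp [Fin.val_add]
    omega

lemma exists_triangleMap_iterate_eq (x : Σ i, Fin (s i)) :
    ∃ n, (triangleMap S hs)^[n] x = ⟨0, 0, by have := hs 0; omega⟩ := by
  set y := (triangleMap S hs)^[(x.2 : ℕ)] x with hy
  have hy0 : (y.2 : ℕ) = 0 := by
    have := triangleMap_iterate_snd_le (S := S) (hs := hs) (x := x) x.2
    rwa [Nat.sub_self, Nat.le_zero] at this
  refine ⟨(-y.1).val + x.2, ?_⟩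
  rw [iterate_add_apply, ← hy, triangleMap_iterate_eq_iff hy0]
  simp

lemma triangleMap_triangleMap_ne (x : Σ i, Fin (s i)) :
    triangleMap S hs (triangleMap S hs x) ≠ x := by
  intro h
  obtain hx | hx := eq_or_ne (x.2 : ℕ) 0
  · have := ((triangleMap_iterate_eq_iff hx 2).1 h).1
    simp at this
  · have := triangleMap_iterate_snd_le (S := S) (hs := hs) (x := x) 2
    rw [show (triangleMap S hs)^[2] x = x from h] at this
    omega

lemma triangleWithTrees_adj_iff :
    (triangleWithTrees (fun i => (S i).tree) s).Adj x y ↔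
      triangleMap S hs x = y ∨ triangleMap S hs y = x := by
  have hne (x : Σ i, Fin (s i)) : triangleMap S hs x ≠ x := fun h =>
    triangleMap_triangleMap_ne (S := S) (hs := hs) x (by rw [h, h])
  have hmap {i j : Fin 3} {a : Fin (s i)} {b : Fin (s j)} : triangleMap S hs ⟨i, a⟩ = ⟨j, b⟩ ↔
      if (a : ℕ) = 0 then i + 1 = j ∧ (b : ℕ) = 0
      else i = j ∧ min (a - 1 : ℕ) (S i).hub = b := by
    split_ifs with ha
    exacts [triangleMap_eq_iff_of_eq_zero ha, triangleMap_eq_iff_of_ne_zero ha]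
  obtain ⟨i, a⟩ := x
  obtain ⟨j, b⟩ := y
  obtain rfl | hij := eq_or_ne i j
  · rw [triangleWithTrees_adj_mk_mk, BranchShape.tree_adj]
    obtain rfl | hab := eq_or_ne a b
    · simp [hne]
    · have := Fin.val_injective.ne hab
      rw [hmap, hmap, and_iff_right hab]
      split_ifs <;> omega
  · rw [triangleWithTrees_adj_of_ne hij, hmap, hmap]
    have : i + 1 = j ∨ j + 1 = i := by omega
    split_ifs <;> omega

variable {V : Type*} [Fintype V] {G : SimpleGraph V} {φ : V → V} {f : (Σ i, Fin (s i)) ≃ V}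

open FunctionalGraph

namespace triangleMap

lemma apply_mem_core_iff (hf : Semiconj f (triangleMap S hs) φ) :
    f x ∈ core φ ↔ (x.2 : ℕ) = 0 := by
  constructor
  · intro hx
    obtain ⟨n, hn, hper⟩ := mem_core.1 hx
    have hiter : (triangleMap S hs)^[n] x = x :=
      f.injective (((hf.iterate_right n).eq x).trans hper)
    have := triangleMap_iterate_snd_le (S := S) (hs := hs) (x := x) n
    rw [hiter] at this
    omega
  · intro hx
    refine mem_core_of_iterate_eq (i := 3) (by norm_num) ?_
    rw [← (hf.iterate_right 3).eq, (triangleMap_iterate_eq_iff hx 3).2 ⟨by simp, hx⟩]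

lemma apply_mem_children_iff (hf : Semiconj f (triangleMap S hs) φ) :
    f y ∈ children φ (f x) ↔
      (y.2 : ℕ) ≠ 0 ∧ y.1 = x.1 ∧ min (y.2 - 1 : ℕ) (S y.1).hub = x.2 := by
  rw [mem_children, apply_mem_core_iff hf, ← hf.eq, f.injective.eq_iff]
  exact and_congr_right triangleMap_eq_iff_of_ne_zero

lemma apply_mem_branch_iff (hf : Semiconj f (triangleMap S hs) φ) (hx : (x.2 : ℕ) = 0) :
    f y ∈ branch φ (f x) ↔ y.1 = x.1 := by
  have hxc := (apply_mem_core_iff hf).2 hx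
  induction hn : (y.2 : ℕ) using Nat.strong_induction_on generalizing y with
  | _ n ih =>
  subst hn
  obtain hy | hy := eq_or_ne (y.2 : ℕ) 0
  · rw [mem_branch_iff_of_mem_core hxc ((apply_mem_core_iff hf).2 hy), f.injective.eq_iff,
      sigma_fin_eq_iff, hx, and_iff_left hy]
  · have hyc : f y ∉ core φ := mt (apply_mem_core_iff hf).1 hy
    have hstep : f y ∈ branch φ (f x) ↔ φ (f y) ∈ branch φ (f x) :=
      ⟨fun h => map_mem_branch h fun hyx => hyc (hyx ▸ hxc),
        fun h => mem_branch_of_map_mem_branch h hyc⟩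
    have hlt : ((triangleMap S hs y).2 : ℕ) < y.2 := by
      have := triangleMap_snd_le (S := S) (hs := hs) y
      omega
    rw [hstep, ← hf.eq, ((triangleMap_eq_iff_of_ne_zero hy).1 rfl).1]
    exact ih _ hlt rfl

lemma card_branch_apply (hf : Semiconj f (triangleMap S hs) φ) (hx : (x.2 : ℕ) = 0) :
    (branch φ (f x)).card = s x.1 := by
  have hbranch : branch φ (f x) =
      univ.map ((Embedding.sigmaMk x.1).trans f.toEmbedding) := by
    ext v
    obtain ⟨⟨j, b⟩, rfl⟩ := f.surjective v
    rw [apply_mem_branch_iff hf hx]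
    simp only [mem_map, mem_univ, true_and, Embedding.trans_apply, Equiv.coe_toEmbedding,
      f.injective.eq_iff]
    exact ⟨fun h => by cases (h : j = x.1); exact ⟨b, rfl⟩,
      fun ⟨_, ha⟩ => (congrArg Sigma.fst ha).symm⟩
  rw [hbranch, card_map, card_univ, Fintype.card_fin]

lemma children_apply_eq_singleton (hf : Semiconj f (triangleMap S hs) φ) (hxy : y.1 = x.1)
    (hy : (y.2 : ℕ) = x.2 + 1) (hx : (x.2 : ℕ) < (S x.1).hub) : children φ (f x) = {f y} := by
  ext v
  obtain ⟨z, rfl⟩ := f.surjective v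
  rw [apply_mem_children_iff hf, mem_singleton, f.injective.eq_iff, sigma_fin_eq_iff]
  have (h : z.1 = x.1) : (S z.1).hub = (S x.1).hub := by rw [h]
  grind

lemma isCenterStarAt_apply (hf : Semiconj f (triangleMap S hs) φ) (hx : (x.2 : ℕ) = (S x.1).hub) :
    IsCenterStarAt φ (f x) := by
  intro w hw
  obtain ⟨y, rfl⟩ := f.surjective w
  refine eq_empty_of_forall_notMem fun u hu => ?_
  obtain ⟨z, rfl⟩ := f.surjective u
  rw [apply_mem_children_iff hf] at hw hu
  have hy : (S y.1).hub = (S x.1).hub := by rw [hw.2.1]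
  have hz : (S z.1).hub = (S x.1).hub := by rw [hu.2.1, hw.2.1]
  omega

lemma children_apply_nonempty (hf : Semiconj f (triangleMap S hs) φ)
    (hx : (x.2 : ℕ) = (S x.1).hub) : (children φ (f x)).Nonempty := by
  have := hs x.1
  have := (S x.1).hub_le_two
  exact ⟨f ⟨x.1, x.2 + 1, by omega⟩, (apply_mem_children_iff hf).2 ⟨by simp, rfl, by simp [hx]⟩⟩

lemma hasShape_apply (hf : Semiconj f (triangleMap S hs) φ) (hx : (x.2 : ℕ) = 0) :
    HasShape φ (f x) (S x.1) := by
  have := hs x.1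
  set y : Σ i, Fin (s i) := ⟨x.1, 1, by omega⟩
  set z : Σ i, Fin (s i) := ⟨x.1, 2, by omega⟩
  cases hS : S x.1 with
  | centerStar => exact isCenterStarAt_apply hf (by rw [hx, hS]; rfl)
  | leafStar =>
    have hy : (y.2 : ℕ) = (S y.1).hub := by rw [hS]; rfl
    exact ⟨f y, children_apply_eq_singleton hf rfl (by rw [hx]) (by rw [hx, hS]; exact one_pos),
      children_apply_nonempty hf hy, isCenterStarAt_apply hf hy⟩
  | zTree =>
    have hz : (z.2 : ℕ) = (S z.1).hub := by rw [hS]; rfl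
    exact ⟨f y, children_apply_eq_singleton hf rfl (by rw [hx]) (by rw [hx, hS]; exact two_pos),
      f z, children_apply_eq_singleton hf rfl rfl (by rw [hS]; exact one_lt_two),
      children_apply_nonempty hf hz, isCenterStarAt_apply hf hz⟩

lemma hasBranches (hf : Semiconj f (triangleMap S hs) φ) : HasBranches φ S s := by
  have hpos (i : Fin 3) : 0 < s i := by have := hs i; omega
  refine ⟨fun i => f ⟨i, 0, hpos i⟩, ⟨fun i j hij => ?_, fun v => ?_⟩, fun i =>
    ⟨hasShape_apply hf rfl, card_branch_apply hf rfl⟩⟩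
  · exact (sigma_fin_eq_iff.1 (f.injective hij)).1
  · obtain ⟨x, rfl⟩ := f.surjective v
    rw [apply_mem_core_iff hf]
    exact ⟨fun hx => ⟨x.1, congrArg f (sigma_fin_eq_iff.2 ⟨rfl, hx.symm⟩)⟩,
      fun ⟨i, hi⟩ => (sigma_fin_eq_iff.1 (f.injective hi)).2.symm⟩

end triangleMap

lemma exists_isOrientation_of_iso (hs : ∀ i, 4 ≤ s i)
    (f : triangleWithTrees (fun i => (S i).tree) s ≃g G) :
    ∃ φ, IsOrientation G φ ∧ HasBranches φ S s := by
  let φ : V → V := f ∘ triangleMap S hs ∘ f.symm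
  have hf : Semiconj f.toEquiv (triangleMap S hs) φ := fun x =>
    congrArg (f ∘ triangleMap S hs) (f.symm_apply_apply x).symm
  refine ⟨φ, ⟨?_, ?_, f ⟨0, 0, ?_⟩, ?_⟩, triangleMap.hasBranches hf⟩
  · refine f.surjective.forall₂.2 fun x y => ?_
    rw [f.map_adj_iff, triangleWithTrees_adj_iff (hs := hs)]
    exact or_congr (by rw [← f.injective.eq_iff]; exact (hf.eq x).congr_left)
      (by rw [← f.injective.eq_iff]; exact (hf.eq y).congr_left)
  · refine f.surjective.forall.2 fun x => ?_
    have hiter : f (triangleMap S hs (triangleMap S hs x)) = φ (φ (f x)) :=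
      (hf.iterate_right 2).eq x
    rw [← hiter]
    exact f.injective.ne (triangleMap_triangleMap_ne x)
  · have := hs 0
    omega
  · refine f.surjective.forall.2 fun x => ?_
    obtain ⟨n, hn⟩ := exists_triangleMap_iterate_eq (S := S) (hs := hs) x
    exact ⟨n, ((hf.iterate_right n).eq x).symm.trans (congrArg f hn)⟩

end TriangleMap

section Minimum

open FunctionalGraph

variable {V : Type*} [Fintype V] {G : SimpleGraph V} {φ : V → V} {v : V} {k : ℕ}
  {S : Fin 3 → BranchShape} {s : Fin 3 → ℕ}

lemma FunctionalGraph.HasShape.deg_eq_three {σ : BranchShape} (h : HasShape φ v σ)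
    (hv : v ∈ core φ) (hσ : σ ≠ .centerStar) : deg φ v = 3 :=
  match σ, h with
  | .centerStar, _ => absurd rfl hσ
  | .leafStar, ⟨_, hw, _⟩ => deg_eq_three_of_children_eq_singleton hv hw
  | .zTree, ⟨_, hw, _⟩ => deg_eq_three_of_children_eq_singleton hv hw

lemma IsOrientation.augmentedZagrebIndex_eq_of_hasBranches (h : IsOrientation G φ)
    (hb : HasBranches φ S s) (hS₁ : S 1 ≠ .centerStar) (hS₂ : S 2 ≠ .centerStar) :
    augmentedZagrebIndex G = Fintype.card V +
      ((S 0).charge (s 0) + (S 1).charge (s 1) + (S 2).charge (s 2)) := by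
  obtain ⟨t, ht, hSs⟩ := hb
  have hcharge (i : Fin 3) : charge φ (t i) = (S i).charge (s i) := by
    rw [(hSs i).1.charge_eq (ht.mem_core i), (hSs i).2]
  have hdeg : ∀ v ∈ core φ, v ≠ t 0 → deg φ v = 3 := fun v hv hv0 => by
    obtain ⟨i, rfl⟩ := (ht.mem_core_iff v).1 hv
    refine (hSs i).1.deg_eq_three hv ?_
    match i with
    | 0 => exact absurd rfl hv0
    | 1 => exact hS₁
    | 2 => exact hS₂
  rw [h.augmentedZagrebIndex_eq_add_sum_charge fun v hv => ?_, ht.sum_core, hcharge, hcharge,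
    hcharge]
  obtain rfl | hv0 := eq_or_ne v (t 0)
  · exact Or.inr (hdeg _ (map_mem_core hv) (h.map_ne _))
  · exact Or.inl (hdeg v hv hv0)

lemma IsOrientation.mem_unicyclicApexTrees_iff (h : IsOrientation G φ) :
    G ∈ unicyclicApexTrees V k ↔
      (∀ v ∈ core φ, k ≤ (branch φ v).card) ∧ ∃ v ∈ core φ, (branch φ v).card = k :=
  (and_iff_right h.isUnicyclic).trans (h.isApexTree_iff k)

lemma IsOrientation.mem_unicyclicApexTrees_of_hasBranches (h : IsOrientation G φ)
    (hb : HasBranches φ S s) (hs : ∀ i, s 0 ≤ s i) : G ∈ unicyclicApexTrees V (s 0) := by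
  obtain ⟨t, ht, hSs⟩ := hb
  refine h.mem_unicyclicApexTrees_iff.2 ⟨fun v hv => ?_, t 0, ht.mem_core 0, (hSs 0).2⟩
  obtain ⟨i, rfl⟩ := (ht.mem_core_iff v).1 hv
  exact (hs i).trans_eq (hSs i).2.symm

lemma exists_isOrientation_hasBranches (hs : ∀ i, 4 ≤ s i) (hsum : ∑ i, s i = Fintype.card V) :
    ∃ (G : SimpleGraph V) (φ : V → V), IsOrientation G φ ∧ HasBranches φ S s := by
  have hcard : Fintype.card (Σ i, Fin (s i)) = Fintype.card V := by
    simp only [Fintype.card_sigma, Fintype.card_fin, hsum]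
  exact ⟨_, exists_isOrientation_of_iso (S := S) hs
    (SimpleGraph.Iso.map (Fintype.equivOfCardEq hcard) _)⟩

theorem hasMinAZI_iff_nonempty_iso (σ₀ σ₁ σ₂ : BranchShape) {s₀ s₁ s₂ : ℕ} (h₀ : 4 ≤ s₀)
    (h₁ : s₀ ≤ s₁) (h₂ : s₀ ≤ s₂) (hsum : s₀ + s₁ + s₂ = Fintype.card V)
    (hσ₁ : σ₁ ≠ .centerStar) (hσ₂ : σ₂ ≠ .centerStar)
    (hopt : ∀ (H : SimpleGraph V) (φ : V → V), IsOrientation H φ →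
      (∀ v ∈ core φ, s₀ ≤ (branch φ v).card) → (∃ v ∈ core φ, (branch φ v).card = s₀) →
      augmentedZagrebIndex H ≤
        Fintype.card V + (σ₀.charge s₀ + σ₁.charge s₁ + σ₂.charge s₂) →
      HasBranches φ ![σ₀, σ₁, σ₂] ![s₀, s₁, s₂]) :
    HasMinAZI (unicyclicApexTrees V s₀) G ↔
      Nonempty (G ≃g triangleWithTrees ![σ₀.tree, σ₁.tree, σ₂.tree] ![s₀, s₁, s₂]) := by
  let S := ![σ₀, σ₁, σ₂]
  let s := ![s₀, s₁, s₂]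
  have htree : (fun i => (S i).tree) = ![σ₀.tree, σ₁.tree, σ₂.tree] :=
    funext fun | 0 | 1 | 2 => rfl
  have hs : ∀ i, s₀ ≤ s i := fun | 0 => le_rfl | 1 => h₁ | 2 => h₂
  have hs4 (i : Fin 3) : 4 ≤ s i := h₀.trans (hs i)
  have hmem {H : SimpleGraph V} {φ : V → V} (h : IsOrientation H φ) (hb : HasBranches φ S s) :=
    h.mem_unicyclicApexTrees_of_hasBranches hb hs
  have hAZI {H : SimpleGraph V} {φ : V → V} (h : IsOrientation H φ) (hb : HasBranches φ S s) :=
    h.augmentedZagrebIndex_eq_of_hasBranches hb hσ₁ hσ₂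
  rw [← htree]
  constructor
  · rintro ⟨hG, hmin⟩
    obtain ⟨φ, h⟩ := hG.1.exists_isOrientation
    obtain ⟨M, μ, hM, hb⟩ := exists_isOrientation_hasBranches (S := S) hs4
      ((Fin.sum_univ_three s).trans hsum)
    obtain ⟨hsize, hk⟩ := h.mem_unicyclicApexTrees_iff.1 hG
    exact h.nonempty_iso (hopt G φ h hsize hk ((hmin M (hmem hM hb)).trans_eq (hAZI hM hb)))
  · rintro ⟨f⟩
    obtain ⟨φ, h, hb⟩ := exists_isOrientation_of_iso hs4 f.symm
    refine ⟨hmem h hb, fun H hH => ?_⟩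
    by_contra! hlt
    obtain ⟨ψ, hψ⟩ := hH.1.exists_isOrientation
    obtain ⟨hsize, hk⟩ := hψ.mem_unicyclicApexTrees_iff.1 hH
    have hbH := hopt H ψ hψ hsize hk (hlt.le.trans_eq (hAZI h hb))
    exact hlt.ne ((hAZI hψ hbH).trans (hAZI h hb).symm)

end Minimum

theorem proposition3p1 {V : Type*} [Fintype V] (n k : ℕ) (hV : Fintype.card V = n)
    (hn : 3 * k + 3 ≤ n) (G₀ : SimpleGraph V) :
    (7 ≤ k → (HasMinAZI (unicyclicApexTrees V k) G₀ ↔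
      Nonempty (G₀ ≃g graphA k ((n - k) / 2) ((n - k + 1) / 2)))) ∧
    (k = 6 → (HasMinAZI (unicyclicApexTrees V k) G₀ ↔
      Nonempty (G₀ ≃g graphB 6 (n / 2 - 3) ((n + 1) / 2 - 3)))) ∧
    (4 ≤ k ∧ k ≤ 5 → (HasMinAZI (unicyclicApexTrees V k) G₀ ↔
      Nonempty (G₀ ≃g graphC k k (n - 2 * k)))) := by
  subst hV
  refine ⟨fun hk => ?_, ?_, fun hk => ?_⟩
  · exact hasMinAZI_iff_nonempty_iso .zTree .zTree .zTree (by omega) (by omega) (by omega)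
      (by omega) nofun nofun fun H φ h hsize ⟨_, hx, hxk⟩ hAZI =>
        h.hasBranches_graphA hk hn hsize hx hxk hAZI
  · rintro rfl
    exact hasMinAZI_iff_nonempty_iso .centerStar .zTree .zTree (by omega) (by omega) (by omega)
      (by omega) nofun nofun fun H φ h hsize ⟨_, hx, hx6⟩ hAZI =>
        h.hasBranches_graphB hn hsize hx hx6 hAZI
  · exact hasMinAZI_iff_nonempty_iso .centerStar .leafStar .zTree (by omega) (by omega)
      (by omega) (by omega) nofun nofun fun H φ h hsize _ hAZI =>
        h.hasBranches_graphC (by omega) hn hsize hAZI
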